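/- Let $n\ge 1$ and $0\le n_d\le n$ be integers. Put $g_B=(1\,2)(3\,4)\cdots(2n-1\;2n)$, $g_A=(2\,3)(4\,5)\cdots(2n\;1)$ in $S_{2n}$ (products are composed from right to left), $\tau=g_Ag_B=(1\,3\,5\cdots 2n-1)(2\,4\,6\cdots 2n)^{-1}$, and $\rho=(1\,3\,5\cdots 2n-1)(2\,4\,6\cdots 2n)$. For $g\in S_N$ let $P(g)$ be the partition into cycles (including fixed points); for partitions let $\#$ be the number of blocks, $\#_1$ the number of blocks of length one, and $\vee$ the join in the refinement order. Let $t_A=P(g_A)$, $t_B=P(g_B)$. Let $d$ be the Cayley distance on $S_N$ (the least number of transpositions), and define the genus $G_{g_0}(g)$ by $$d(g_0,g)+d(g,e)=d(g_0,e)+2\bigl(\#P(g_0)-\#(P(g)\vee P(g_0))\bigr)+2G_{g_0}(g).$$ $ANC_{n,n}$ is the set of $g\in S_{2n}$ with $G_\tau(g)=0$ and $\#(P(g)\vee P(\tau))=1$. Let $NC'_{n+n_d}$ be the set of permutations $k$ of $n$ ordinary points $a_1,\dots,a_n$ and $n_d$ defects $\delta_1,\dots,\delta_{n_d}$, placed in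 the cyclic order $a_1,\dots,a_n,\delta_1,\dots,\delta_{n_d}$ on a circle, which are non-crossing (each cycle runs through its points in the cyclic order, and distinct cycles do not cross), for which $k(\delta_j)$ and $k^{-1}(\delta_j)$ are ordinary points for all $j$, and $k(a_n)=\delta_1$ if $n_d\ge1$. For $k\in NC'_{n+n_d}$ and $t=2n_d$, the permutation $k\#_t k^{-1}\in S_{2n}$ is obtained by drawing $k$ on the odd points ($a_i=2i-1$) and $k^{-1}$ on the even points ($a_i=2i$), cutting both open at their defects, and joining, for each $j$, the line entering the $j$-th defect on either side to the line leaving the $j$-th defect on the other side. **Theorem.** A partition $q$ of $\{1,\dots,2n\}$ satisfies $$\#_1(q)=2n_d,\qquad \#(q)=n+n_d,\qquad \#(q\vee t_A)+\#(q\vee t_B)=n+n_d+\delta_{n_d,0}$$ if and only if $q=P(\hat h g_B)$ for some $\hat h\in S_{2n}$ with the following properties: 1. If $n_d\ge 1$, then $\hat h\in ANC_{n,n}$. If $n_d=0$, then $G_\tau(\hat h)=0$ and $\hat h$ maps odd points to odd points and even points to even points. 2. There is a set $D$ of $2n_d$ points (the vertically aligned defects) such that $\hat h(g_B(p))=p$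 for $p\in D$, while for $p\notin D$ the points $\hat h(g_B(p))$ and $g_B(p)$ have the same parity and $\hat h(g_B(\hat h(g_B(p))))=p$ (so away from the defects $\hat h$ connects only odd points with odd points and even points with even points, and the two parts are inverse to each other under $2i-1\leftrightarrow 2i$). 3. Up to a rotation $\hat h$ is of the form $k\#_t k^{-1}$ with $t=2n_d$: there are $r\ge 0$ and $k\in NC'_{n+n_d}$ with $\hat h=\rho^r\,(k\#_t k^{-1})\,\rho^{-r}$. -/

import Mathlib

namespace AnnularNC

open Equiv

/-! ### Set partitions and permutations -/

/-- The number of blocks of a set partition (a partition of `α` is given as a setoid on `α`,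
so that `≤` is refinement and `⊔` is the join in the lattice of partitions). -/
noncomputable def numBlocks {α : Type*} (q : Setoid α) : ℕ := Nat.card (Quotient q)

/-- The number of blocks of length one. -/
noncomputable def numSingletons {α : Type*} (q : Setoid α) : ℕ :=
  Nat.card {x : α // ∀ y, q x y → y = x}

/-- The partition of `α` into the cycles of a permutation (fixed points are cycles). -/
def cyclePartition {α : Type*} (g : Perm α) : Setoid α := Perm.SameCycle.setoid g

/-- The Cayley distance: the least number of transpositions leading from `g` to `h`. -/
noncomputable def cayleyDist {α : Type*} [DecidableEq α] (g h : Perm α) : ℕ :=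
  sInf {m | ∃ l : List (Perm α), (∀ s ∈ l, s.IsSwap) ∧ g * l.prod = h ∧ l.length = m}

/-- The genus `G` of `g` based over `g₀`, defined by
`d(g₀, g) + d(g, e) = d(g₀, e) + 2 (#(g₀) - #(g ∨ g₀)) + 2 G`. -/
noncomputable def genus {α : Type*} [DecidableEq α] (g₀ g : Perm α) : ℚ :=
  ((cayleyDist g₀ g : ℚ) + cayleyDist g 1 - cayleyDist g₀ 1
    - 2 * ((numBlocks (cyclePartition g₀) : ℚ)
        - numBlocks (cyclePartition g ⊔ cyclePartition g₀))) / 2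

/-- Multi-annular non-crossing permutations for `g₀`: genus zero and fully connected. -/
def IsANC {α : Type*} [DecidableEq α] (g₀ g : Perm α) : Prop :=
  genus g₀ g = 0 ∧ numBlocks (cyclePartition g ⊔ cyclePartition g₀) = 1

/-- Going around the circle from `a` in increasing direction, one meets `b` strictly before `c`,
all three being distinct. -/
def CyclicBetween {N : ℕ} (a b c : Fin N) : Prop :=
  (a < b ∧ b < c) ∨ (b < c ∧ c < a) ∨ (c < a ∧ a < b)

/-- Non-crossing permutations of `N` points in cyclic order on the boundary of a disk:
every cycle runs through its points in the cyclic order, and no two cycles cross. -/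
def IsNC {N : ℕ} (g : Perm (Fin N)) : Prop :=
  (∀ x y, g.SameCycle x y → ¬ CyclicBetween x y (g x)) ∧
  (∀ a b c d, a < b → b < c → c < d → g.SameCycle a c → g.SameCycle b d → g.SameCycle a b)

/-! ### The `2 n` points -/

/-- The `i`-th point of the top boundary: the `1, 3, …, 2 n - 1` (counting from one). -/
def top {n : ℕ} (i : Fin n) : Fin (2 * n) := ⟨2 * i.1, by omega⟩

/-- The `i`-th point of the bottom boundary: the `2, 4, …, 2 n` (counting from one). -/
def bot {n : ℕ} (i : Fin n) : Fin (2 * n) := ⟨2 * i.1 + 1, by omega⟩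

/-- Two points lie on the same boundary (both on top or both on the bottom). -/
def SameSide {n : ℕ} (x y : Fin (2 * n)) : Prop := x.1 % 2 = y.1 % 2

/-- `g_B = (1 2)(3 4) ⋯ (2n-1 2n)`. -/
def gB (n : ℕ) : Perm (Fin (2 * n)) :=
  Function.Involutive.toPerm
    (fun p => if hp : p.1 % 2 = 0 then ⟨p.1 + 1, by omega⟩ else ⟨p.1 - 1, by omega⟩)
    (by
      intro p
      apply Fin.ext
      by_cases h : p.1 % 2 = 0
      · have h2 : ¬ (p.1 + 1) % 2 = 0 := by omega
        simp [h, h2]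
      · have h2 : (p.1 - 1) % 2 = 0 := by omega
        simp only [h, h2, dite_true, dite_false]
        omega)

/-- `g_A = (2 3)(4 5) ⋯ (2n 1)`, the shift of `g_B` by one point. -/
def gA (n : ℕ) : Perm (Fin (2 * n)) := finRotate (2 * n) * gB n * (finRotate (2 * n))⁻¹

/-- `τ = g_A g_B = (1 3 5 ⋯ 2n-1)(2 4 6 ⋯ 2n)⁻¹`. -/
def tau (n : ℕ) : Perm (Fin (2 * n)) := gA n * gB n

/-- `t_A = {{2,3}, {4,5}, …, {2n,1}}`. -/
def tA (n : ℕ) : Setoid (Fin (2 * n)) := cyclePartition (gA n)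

/-- `t_B = {{1,2}, {3,4}, …, {2n-1,2n}}`. -/
def tB (n : ℕ) : Setoid (Fin (2 * n)) := cyclePartition (gB n)

/-- The rotation `(1 3 5 ⋯ 2n-1)(2 4 6 ⋯ 2n)` of the annulus by one step. -/
def rotation (n : ℕ) : Perm (Fin (2 * n)) := finRotate (2 * n) ^ 2

/-! ### Cutting and gluing

`Fin (n + d)` carries `n` ordinary points `Fin.castAdd d i` followed in cyclic order by `d`
defect points `Fin.natAdd n j`. -/

/-- Non-crossing permutations of `n` ordinary points and `d` consecutive defects such that every
defect is connected to and from ordinary points, and the first defect is entered from the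
ordinary point directly next to it. -/
def IsDefectNC (n d : ℕ) (k : Perm (Fin (n + d))) : Prop :=
  IsNC k ∧
  (∀ j : Fin d, ∃ i : Fin n, k (Fin.natAdd n j) = Fin.castAdd d i) ∧
  (∀ j : Fin d, ∃ i : Fin n, k (Fin.castAdd d i) = Fin.natAdd n j) ∧
  (∀ (i : Fin n) (j : Fin d), i.1 + 1 = n → j.1 = 0 → k (Fin.castAdd d i) = Fin.natAdd n j)

/-- `h = k #_t l` with `t = 2 d`: draw `k` on the top points and `l` on the bottom points, cut
both open at their defects, and glue, for each `j`, the line entering the `j`-th defect on either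
side to the line leaving the `j`-th defect on the other side. -/
structure IsGluing {n d : ℕ} (k l : Perm (Fin (n + d))) (h : Perm (Fin (2 * n))) : Prop where
  top_top : ∀ i i' : Fin n, k (Fin.castAdd d i) = Fin.castAdd d i' → h (top i) = top i'
  bot_bot : ∀ i i' : Fin n, l (Fin.castAdd d i) = Fin.castAdd d i' → h (bot i) = bot i'
  top_bot : ∀ (i i' : Fin n) (j : Fin d), k (Fin.castAdd d i) = Fin.natAdd n j →
    l (Fin.natAdd n j) = Fin.castAdd d i' → h (top i) = bot i'
  bot_top : ∀ (i i' : Fin n) (j : Fin d), l (Fin.castAdd d i) = Fin.natAdd n j →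
    k (Fin.natAdd n j) = Fin.castAdd d i' → h (bot i) = top i'

/-- The annular diagrams with `2 d` straight crossings.

In the diagram every point has an incoming and an outgoing end, and the outgoing end of `g_B p`
is vertically aligned with the incoming end of `p`; so the `2 n` vertical positions are labelled
by `p`, and the position `p` carries a straight crossing iff `h (g_B p) = p`. -/
structure IsDefectDiagram (n d : ℕ) (h : Perm (Fin (2 * n))) : Prop where
  /-- With defects, `h` is annular non-crossing. -/
  anc : d ≠ 0 → IsANC (tau n) h
  /-- Without defects, `h` has genus zero and does not connect the two boundaries. -/
  factorized : d = 0 → genus (tau n) h = 0 ∧ ∀ x, SameSide (h x) x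
  /-- There are `2 d` vertical defect positions with straight lines, and otherwise `h` connects
  only within the top or the bottom, the two halves being inverse to each other. -/
  straight : ∃ D : Finset (Fin (2 * n)), D.card = 2 * d ∧
    (∀ p ∈ D, h (gB n p) = p) ∧
    (∀ p ∉ D, SameSide (h (gB n p)) (gB n p) ∧ h (gB n (h (gB n p))) = p)
  /-- Up to a rotation of the annulus, `h = k #_t k⁻¹` with `t = 2 d`. -/
  glued : ∃ (r : ℕ) (k : Perm (Fin (n + d))) (h₀ : Perm (Fin (2 * n))),
    IsDefectNC n d k ∧ IsGluing k k⁻¹ h₀ ∧ h = rotation n ^ r * h₀ * (rotation n ^ r)⁻¹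

end AnnularNC

namespace AnnularNC
open Equiv

/-! ### Counting blocks -/

/-! Give every point weight 1, or 2 if it is a singleton of `q`. Each block then weighs at least 2,
and the first two conditions say that the total is twice the number of blocks. So all blocks have
one or two points, and `q` is the cycle partition of an involution `p` with `2 * nd` fixed points.
Put `h = p * gB n`. Everything becomes a statement about a partial matching of `2n` points on a
circle.

Genus and regions. For an involution `p` and a fixed-point-free involution `g` on `N` points, a
block of the join is either a closed alternating loop, giving two cycles of `p * g`, or a path
between two fixed points of `p`, giving one. Hence `4 #(p ∨ g) + |supp p| = 2 #(p g) + N`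
(`four_mul_numBlocks_sup`). The Cayley distances in the genus are `N` minus cycle numbers of `p * gA
n`, `p * gB n` and `tau n`, so genus zero is a linear equation for the number of regions `#(p ∨ t_A)
+ #(p ∨ t_B)` (`genus_mul_gB_eq_zero_iff`). A fixed point of `p` makes `h` join the two sides; this
is the origin of the extra 1 when there are no defects. The converse direction follows from this
equation.

Planarity. The third condition says that the number of regions is extremal, and this forces the
chords not to cross, not to separate unmatched points and to join opposite parities
(`IsExtremal.isCyclicNC`). A counting argument shows that an extremal matching is empty or matches
two neighbours; such a pair is rotated to the end and removed, and extremality survives.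

Gluing. If there are defects, rotate until the last bottom point is unmatched and join the unmatched
points by a rainbow to `2 * nd` new points. The resulting non-crossing perfect matching on a line is
the thickening of a non-crossing permutation `k` of `n + nd` points (`IsLinearNC.isNC`), and cutting
the rainbow gives back `h` as the gluing of `k` and `k⁻¹`. -/

theorem rel_zpow_of_rel {α : Type*} {g : Perm α} {S : Setoid α} (h : ∀ x, S x (g x)) (i : ℤ)
    (x : α) : S x ((g ^ i) x) := by
  induction i using Int.induction_on with
  | zero => simp
  | succ i ih =>
    have h2 := S.trans ih (h _)
    rwa [add_comm, zpow_add, zpow_one, Perm.mul_apply]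
  | pred i ih =>
    have h2 := h (g⁻¹ ((g ^ (-(i : ℤ))) x))
    rw [← Perm.mul_apply g, mul_inv_cancel, Perm.one_apply] at h2
    rw [sub_eq_add_neg, add_comm, zpow_add, zpow_neg_one, Perm.mul_apply]
    exact S.trans ih (S.symm h2)

theorem cyclePartition_le_iff {α : Type*} {g : Perm α} {S : Setoid α} :
    cyclePartition g ≤ S ↔ ∀ x, S x (g x) := by
  constructor
  · intro h x
    exact h (show g.SameCycle x (g x) from ⟨1, by simp⟩)
  · rintro h x y ⟨i, rfl⟩
    exact rel_zpow_of_rel h i x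

theorem cyclePartition_rel_apply {α : Type*} (g : Perm α) (x : α) : cyclePartition g x (g x) :=
  cyclePartition_le_iff.1 le_rfl x

theorem sup_rel_left {α : Type*} (g g' : Perm α) (x : α) :
    (cyclePartition g ⊔ cyclePartition g') x (g x) :=
  cyclePartition_le_iff.1 le_sup_left x

theorem sup_rel_right {α : Type*} (g g' : Perm α) (x : α) :
    (cyclePartition g ⊔ cyclePartition g') x (g' x) :=
  cyclePartition_le_iff.1 le_sup_right x

theorem numBlocks_le_of_map {α β : Type*} [Finite α] {S : Setoid α} {T : Setoid β} (f : α → β)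
    (hf : S ≤ T.comap f) (hs : ∀ y, ∃ x, T (f x) y) : numBlocks T ≤ numBlocks S := by
  refine Nat.card_le_card_of_surjective (Quotient.map f fun x y h => hf h) ?_
  intro y
  induction y using Quotient.inductionOn with
  | h y =>
    obtain ⟨x, hx⟩ := hs y
    exact ⟨⟦x⟧, Quotient.sound hx⟩

theorem numBlocks_le_add_one_of_map {α β : Type*} [Finite α] {S : Setoid α} {T : Setoid β}
    (f : α → β) (b : β) (hf : S ≤ T.comap f) (hs : ∀ y, T b y ∨ ∃ x, T (f x) y) :
    numBlocks T ≤ numBlocks S + 1 := by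
  rw [numBlocks, numBlocks, ← Finite.card_option]
  refine Nat.card_le_card_of_surjective
    (fun o : Option (Quotient S) => o.elim ⟦b⟧ (Quotient.map f fun x y h => hf h)) ?_
  intro y
  induction y using Quotient.inductionOn with
  | h y =>
    rcases hs y with h | ⟨x, hx⟩
    · exact ⟨none, Quotient.sound h⟩
    · exact ⟨some ⟦x⟧, Quotient.sound hx⟩

theorem numBlocks_anti {α : Type*} [Finite α] {S T : Setoid α} (h : S ≤ T) :
    numBlocks T ≤ numBlocks S :=
  numBlocks_le_of_map id h fun y => ⟨y, T.refl y⟩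

theorem numBlocks_strictAnti {α : Type*} [Finite α] {S T : Setoid α} (h : S < T) :
    numBlocks T < numBlocks S := by
  by_contra hc
  have hsurj : Function.Surjective
      (Quotient.map id (fun x y hxy => h.le hxy) : Quotient S → Quotient T) := by
    intro y
    induction y using Quotient.inductionOn with
    | h y => exact ⟨⟦y⟧, rfl⟩
  have hb := hsurj.bijective_of_nat_card_le (not_lt.1 hc)
  refine h.not_ge fun x y hxy => ?_
  exact Quotient.exact (hb.1 (a₁ := ⟦x⟧) (a₂ := ⟦y⟧) (Quotient.sound hxy))

/-- Joining with one transposition merges at most two blocks. The map `φ` redirects the block of `b`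
to that of `a` and is constant on the blocks of the join, so it misses at most the block of `b`,
which `none` supplies. -/
theorem numBlocks_le_sup_swap {α : Type*} [Finite α] [DecidableEq α] (S : Setoid α) (a b : α) :
    numBlocks S ≤ numBlocks (S ⊔ cyclePartition (swap a b)) + 1 := by
  classical
  let φ : α → Quotient S := fun x => if S x b then ⟦a⟧ else ⟦x⟧
  have hφ : S ⊔ cyclePartition (swap a b) ≤ Setoid.ker φ := by
    refine sup_le ?_ (cyclePartition_le_iff.2 ?_)
    · intro x y hxy
      change φ x = φ y
      by_cases hx : S x b
      · have hy : S y b := S.trans (S.symm hxy) hx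
        simp [φ, hx, hy]
      · have hy : ¬ S y b := fun hy => hx (S.trans hxy hy)
        simpa [φ, hx, hy] using Quotient.sound hxy
    · have ha : φ a = ⟦a⟧ := by simp [φ]
      have hb : φ b = ⟦a⟧ := by simp [φ]
      intro x
      change φ x = φ (swap a b x)
      rcases eq_or_ne x a with rfl | hxa
      · rw [swap_apply_left, ha, hb]
      rcases eq_or_ne x b with rfl | hxb
      · rw [swap_apply_right, ha, hb]
      rw [swap_apply_of_ne_of_ne hxa hxb]
  rw [numBlocks, numBlocks, ← Finite.card_option]
  refine Nat.card_le_card_of_surjective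
    (fun o : Option (Quotient (S ⊔ cyclePartition (swap a b))) =>
      o.elim ⟦b⟧ (Quotient.lift φ fun x y h => hφ h)) ?_
  intro y
  induction y using Quotient.inductionOn with
  | h y =>
    by_cases hy : S y b
    · exact ⟨none, Quotient.sound (S.symm hy)⟩
    · exact ⟨some ⟦y⟧, by simp [φ, hy]⟩

theorem sum_eq_sum_blocks {α : Type*} [Fintype α] (S : Setoid α) [DecidableRel S]
    (w : α → ℕ) [Fintype (Quotient S)] :
    ∑ x, w x = ∑ c : Quotient S, ∑ y with S c.out y, w y := by
  classical
  rw [← Finset.sum_fiberwise (s := Finset.univ) (g := fun x : α => (⟦x⟧ : Quotient S))]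
  refine Finset.sum_congr rfl fun c _ => Finset.sum_congr ?_ fun _ _ => rfl
  ext x
  simp only [Finset.mem_filter, Finset.mem_univ, true_and]
  rw [← Quotient.out_eq c, Quotient.eq, Quotient.out_eq c]
  exact ⟨fun h => S.symm h, fun h => S.symm h⟩

/-- If every block has weight at least `c`, then there are at most `∑ w / c` blocks. -/
theorem mul_numBlocks_le {α : Type*} [Fintype α] (S : Setoid α) [DecidableRel S] (w : α → ℕ)
    (c : ℕ) (h : ∀ x, c ≤ ∑ y with S x y, w y) : c * numBlocks S ≤ ∑ x, w x := by
  classical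
  rw [sum_eq_sum_blocks S w, numBlocks, Nat.card_eq_fintype_card, mul_comm, ← smul_eq_mul,
    ← Finset.card_univ]
  exact Finset.card_nsmul_le_sum _ _ _ fun x _ => h _

theorem mul_numBlocks_eq {α : Type*} [Fintype α] (S : Setoid α) [DecidableRel S] (w : α → ℕ)
    (c : ℕ) (h : ∀ x, ∑ y with S x y, w y = c) : c * numBlocks S = ∑ x, w x := by
  classical
  rw [sum_eq_sum_blocks S w, numBlocks, Nat.card_eq_fintype_card]
  simp [h, mul_comm]

/-- If every block has weight at least `c` and the total weight is minimal, then every block has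
weight `c`. -/
theorem sum_block_eq {α : Type*} [Fintype α] (S : Setoid α) [DecidableRel S] (w : α → ℕ)
    (c : ℕ) (h : ∀ x, c ≤ ∑ y with S x y, w y) (hle : ∑ x, w x ≤ c * numBlocks S) (x : α) :
    ∑ y with S x y, w y = c := by
  classical
  rw [sum_eq_sum_blocks S w, numBlocks, Nat.card_eq_fintype_card] at hle
  have hsum : ∑ _d : Quotient S, c = ∑ d : Quotient S, ∑ y with S d.out y, w y := by
    refine le_antisymm (Finset.sum_le_sum fun d _ => h _) (hle.trans ?_)
    simp [mul_comm]
  have h2 := (Finset.sum_eq_sum_iff_of_le fun d _ => h d.out).1 hsum ⟦x⟧ (Finset.mem_univ _)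
  rw [h2]
  refine Finset.sum_congr ?_ fun _ _ => rfl
  ext y
  have hx : S x (⟦x⟧ : Quotient S).out := S.symm (Quotient.mk_out x)
  simp only [Finset.mem_filter, Finset.mem_univ, true_and]
  exact ⟨fun hy => S.trans (S.symm hx) hy, fun hy => S.trans hx hy⟩

theorem numBlocks_congr {α β : Type*} [Finite α] [Finite β] {S : Setoid α} {T : Setoid β}
    (e : α ≃ β) (h : ∀ x y, S x y ↔ T (e x) (e y)) : numBlocks S = numBlocks T :=
  Nat.card_congr (Quotient.congr e h)

theorem sup_le_comap_conj {α : Type*} (c g g' : Perm α) :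
    cyclePartition g ⊔ cyclePartition g' ≤
      (cyclePartition (c * g * c⁻¹) ⊔ cyclePartition (c * g' * c⁻¹)).comap c := by
  refine sup_le (cyclePartition_le_iff.2 fun x => ?_) (cyclePartition_le_iff.2 fun x => ?_)
  · simpa [Setoid.comap_rel] using sup_rel_left (c * g * c⁻¹) (c * g' * c⁻¹) (c x)
  · simpa [Setoid.comap_rel] using sup_rel_right (c * g * c⁻¹) (c * g' * c⁻¹) (c x)

theorem numBlocks_sup_conj {α : Type*} [Finite α] (c g g' : Perm α) :
    numBlocks (cyclePartition (c * g * c⁻¹) ⊔ cyclePartition (c * g' * c⁻¹)) =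
      numBlocks (cyclePartition g ⊔ cyclePartition g') := by
  symm
  refine numBlocks_congr c fun x y => ⟨fun h => sup_le_comap_conj c g g' h, fun h => ?_⟩
  have h2 := sup_le_comap_conj c⁻¹ (c * g * c⁻¹) (c * g' * c⁻¹) h
  have e : ∀ u : Perm α, c⁻¹ * (c * u * c⁻¹) * c⁻¹⁻¹ = u := fun u => by group
  rw [e, e] at h2
  simpa [Setoid.comap_rel] using h2

theorem numBlocks_cyclePartition_conj {α : Type*} [Finite α] (c g : Perm α) :
    numBlocks (cyclePartition (c * g * c⁻¹)) = numBlocks (cyclePartition g) := by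
  simpa using numBlocks_sup_conj c g g

theorem cyclePartition_inv {α : Type*} (g : Perm α) :
    cyclePartition g⁻¹ = cyclePartition g := by
  ext x y
  exact Perm.sameCycle_inv

/-! ### The Cayley distance -/

theorem numBlocks_cyclePartition_one {α : Type*} [Fintype α] :
    numBlocks (cyclePartition (1 : Perm α)) = Fintype.card α := by
  classical
  have h := mul_numBlocks_eq (cyclePartition (1 : Perm α)) (fun _ => 1) 1 (fun x => by
    have : ∀ y, cyclePartition (1 : Perm α) x y ↔ x = y := fun y => Perm.sameCycle_one
    simp only [this, Finset.sum_const, smul_eq_mul, mul_one]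
    rw [Finset.filter_eq, if_pos (Finset.mem_univ _), Finset.card_singleton])
  simpa using h

theorem swap_mul_le_sup {α : Type*} [DecidableEq α] (s g : Perm α) :
    cyclePartition (s * g) ≤ cyclePartition g ⊔ cyclePartition s :=
  cyclePartition_le_iff.2 fun x =>
    Setoid.trans' _ (sup_rel_left g s x) (sup_rel_right g s (g x))

theorem numBlocks_le_swap_mul_add_one {α : Type*} [Finite α] [DecidableEq α] (g : Perm α)
    (a b : α) :
    numBlocks (cyclePartition g) ≤ numBlocks (cyclePartition (swap a b * g)) + 1 :=
  (numBlocks_le_sup_swap _ a b).trans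
    (Nat.add_le_add_right (numBlocks_anti (swap_mul_le_sup _ _)) 1)

/-- The identity has `card α` cycles and each transposition lowers the number by at most one. This
is the lower bound for the Cayley distance. -/
theorem card_le_numBlocks_prod_add_length {α : Type*} [Fintype α] [DecidableEq α]
    (l : List (Perm α)) (hl : ∀ s ∈ l, s.IsSwap) :
    Fintype.card α ≤ numBlocks (cyclePartition l.prod) + l.length := by
  induction l with
  | nil => simp [numBlocks_cyclePartition_one]
  | cons s l ih =>
    have h1 := ih fun t ht => hl t (List.mem_cons_of_mem _ ht)
    obtain ⟨a, b, -, rfl⟩ := hl s List.mem_cons_self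
    have h2 := numBlocks_le_swap_mul_add_one l.prod a b
    simp only [List.prod_cons, List.length_cons]
    omega

theorem numBlocks_le_card {α : Type*} [Fintype α] (S : Setoid α) :
    numBlocks S ≤ Fintype.card α := by
  rw [← Nat.card_eq_fintype_card]
  exact Nat.card_le_card_of_surjective _ Quotient.mk_surjective

/-- The transposition cuts `x` out of its cycle as a fixed point. Iterating this factors `g` into as
few transpositions as possible. -/
theorem swap_mul_lt {α : Type*} [DecidableEq α] (g : Perm α) (x : α) (hx : g x ≠ x) :
    cyclePartition (swap x (g x) * g) < cyclePartition g := by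
  refine lt_of_le_of_ne ?_ ?_
  · refine (swap_mul_le_sup _ _).trans (sup_le le_rfl (cyclePartition_le_iff.2 fun y => ?_))
    rcases eq_or_ne y x with rfl | hy
    · rw [swap_apply_left]; exact cyclePartition_rel_apply g y
    rcases eq_or_ne y (g x) with rfl | hy'
    · rw [swap_apply_right]; exact Setoid.symm' _ (cyclePartition_rel_apply g x)
    rw [swap_apply_of_ne_of_ne hy hy']
  · intro heq
    have h1 : (swap x (g x) * g).SameCycle x (g x) := by
      change cyclePartition _ _ _
      rw [heq]; exact cyclePartition_rel_apply g x
    have h2 : Function.IsFixedPt (swap x (g x) * g) x := by simp [Function.IsFixedPt]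
    exact hx (h1.eq_of_left h2).symm

theorem exists_swaps {α : Type*} [Fintype α] [DecidableEq α] (g : Perm α) :
    ∃ l : List (Perm α), (∀ s ∈ l, s.IsSwap) ∧ l.prod = g ∧
      l.length + numBlocks (cyclePartition g) = Fintype.card α := by
  suffices h : ∃ l : List (Perm α), (∀ s ∈ l, s.IsSwap) ∧ l.prod = g ∧
      l.length + numBlocks (cyclePartition g) ≤ Fintype.card α by
    obtain ⟨l, h1, h2, h3⟩ := h
    have h4 := card_le_numBlocks_prod_add_length l h1
    rw [h2] at h4
    exact ⟨l, h1, h2, by omega⟩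
  induction hm : Fintype.card α - numBlocks (cyclePartition g) using Nat.strong_induction_on
    generalizing g with
  | _ m ih =>
    by_cases hg : g = 1
    · subst hg
      exact ⟨[], by simp, rfl, by simpa using numBlocks_le_card _⟩
    · obtain ⟨x, hx⟩ : ∃ x, g x ≠ x := by
        by_contra! hc
        exact hg (Perm.ext hc)
      have hlt := numBlocks_strictAnti (swap_mul_lt g x hx)
      have hle := numBlocks_le_card (cyclePartition (swap x (g x) * g))
      obtain ⟨l, h1, h2, h3⟩ := ih
        (Fintype.card α - numBlocks (cyclePartition (swap x (g x) * g))) (by omega) _ rfl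
      refine ⟨swap x (g x) :: l, ?_, ?_, ?_⟩
      · intro s hs
        rcases List.mem_cons.1 hs with rfl | hs
        · exact ⟨x, g x, hx.symm, rfl⟩
        · exact h1 s hs
      · rw [List.prod_cons, h2, swap_mul_self_mul]
      · rw [List.length_cons]; omega

theorem cayleyDist_add_numBlocks {α : Type*} [Fintype α] [DecidableEq α] (g h : Perm α) :
    cayleyDist g h + numBlocks (cyclePartition (g⁻¹ * h)) = Fintype.card α := by
  obtain ⟨l, h1, h2, h3⟩ := exists_swaps (g⁻¹ * h)
  suffices cayleyDist g h = l.length by omega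
  refine IsLeast.csInf_eq ⟨⟨l, h1, by rw [h2, mul_inv_cancel_left], rfl⟩, ?_⟩
  rintro m ⟨l', h1', h2', rfl⟩
  have h4 := card_le_numBlocks_prod_add_length l' h1'
  have h5 : l'.prod = g⁻¹ * h := by rw [← h2', inv_mul_cancel_left]
  rw [h5] at h4
  omega

/-- The parity of the number of cycles is determined by the sign, which a transposition flips.
Combined with bounds in both directions, this fixes the change to be exactly one. -/
theorem odd_numBlocks_swap_mul {α : Type*} [Fintype α] [DecidableEq α] (g : Perm α) {a b : α}
    (hab : a ≠ b) :
    numBlocks (cyclePartition g) % 2 ≠ numBlocks (cyclePartition (swap a b * g)) % 2 := by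
  obtain ⟨l, h1, h2, h3⟩ := exists_swaps g
  obtain ⟨l', h1', h2', h3'⟩ := exists_swaps (swap a b * g)
  have hs := Perm.sign_prod_list_swap h1
  have hs' := Perm.sign_prod_list_swap h1'
  rw [h2', Perm.sign_mul, Perm.sign_swap hab, ← h2, hs] at hs'
  intro hmod
  have h6 : (-1 : ℤˣ) ^ l.length = (-1) ^ l'.length :=
    neg_one_pow_congr (by rw [Nat.even_iff, Nat.even_iff]; omega)
  rw [← h6] at hs'
  simp at hs'

/-! ### Cycles of a product of two involutions -/

theorem mul_self_eq_one_of_involutive {α : Type*} {g : Perm α} (hg : ∀ x, g (g x) = x) :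
    g * g = 1 := Perm.ext hg

theorem inv_eq_self_of_involutive {α : Type*} {g : Perm α} (hg : ∀ x, g (g x) = x) : g⁻¹ = g :=
  inv_eq_of_mul_eq_one_left (mul_self_eq_one_of_involutive hg)

theorem numBlocks_swap_mul_of_sameCycle {α : Type*} [Fintype α] [DecidableEq α] {g : Perm α}
    {a b : α} (hab : a ≠ b) (h : g.SameCycle a b) :
    numBlocks (cyclePartition (swap a b * g)) = numBlocks (cyclePartition g) + 1 := by
  have h1 : cyclePartition (swap a b * g) ≤ cyclePartition g := by
    refine (swap_mul_le_sup _ _).trans (sup_le le_rfl (cyclePartition_le_iff.2 fun y => ?_))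
    rcases eq_or_ne y a with rfl | hy
    · rw [swap_apply_left]; exact h
    rcases eq_or_ne y b with rfl | hy'
    · rw [swap_apply_right]; exact h.symm
    rw [swap_apply_of_ne_of_ne hy hy']
  have h2 := numBlocks_anti h1
  have h3 := odd_numBlocks_swap_mul g hab
  have h4 := numBlocks_le_swap_mul_add_one (swap a b * g) a b
  rw [swap_mul_self_mul] at h4
  omega

/-- Up to the first return of `g` to `a`, the orbit of `a` meets neither `a` nor `b` again, so both
permutations agree along it; at the return, the swap sends it to `b` instead. -/
theorem sameCycle_swap_mul {α : Type*} [Finite α] [DecidableEq α] {g : Perm α} {a b : α}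
    (h : ¬ g.SameCycle a b) : (swap a b * g).SameCycle a b := by
  have hex : ∃ k, 0 < k ∧ (g ^ k) a = a :=
    ⟨orderOf g, orderOf_pos g, by rw [pow_orderOf_eq_one]; rfl⟩
  classical
  obtain ⟨hk0, hka⟩ := Nat.find_spec hex
  set k := Nat.find hex with hk
  have key : ∀ j, j < k → ((swap a b * g) ^ j) a = (g ^ j) a := by
    intro j
    induction j with
    | zero => intro; simp
    | succ j ih =>
      intro hj
      rw [pow_succ', Perm.mul_apply, ih (by omega), Perm.mul_apply, ← Perm.mul_apply g,
        ← pow_succ', swap_apply_of_ne_of_ne]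
      · intro hc
        exact Nat.find_min hex hj ⟨by omega, hc⟩
      · intro hc
        exact h ⟨(j + 1 : ℕ), by rw [zpow_natCast]; exact hc⟩
  refine ⟨k, ?_⟩
  obtain ⟨m, hm⟩ : ∃ m, k = m + 1 := ⟨k - 1, by omega⟩
  rw [zpow_natCast, hm, pow_succ', Perm.mul_apply, key m (by omega), Perm.mul_apply,
    ← Perm.mul_apply g, ← pow_succ', ← hm, hka, swap_apply_left]

theorem numBlocks_swap_mul_of_not_sameCycle {α : Type*} [Fintype α] [DecidableEq α]
    {g : Perm α} {a b : α} (h : ¬ g.SameCycle a b) :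
    numBlocks (cyclePartition (swap a b * g)) + 1 = numBlocks (cyclePartition g) := by
  have hab : a ≠ b := by rintro rfl; exact h (Perm.SameCycle.refl _ _)
  have h2 := numBlocks_swap_mul_of_sameCycle hab (sameCycle_swap_mul h)
  rw [swap_mul_self_mul] at h2
  exact h2.symm

/-- The block of a fixed point of `p` in the join of two involutions is a cycle of `p * g`. -/
theorem sameCycle_mul_iff_sup {α : Type*} {p g : Perm α} (hp : ∀ x, p (p x) = x)
    (hg : ∀ x, g (g x) = x) {a b : α} (ha : p a = a) :
    (p * g).SameCycle a b ↔ (cyclePartition p ⊔ cyclePartition g) a b := by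
  constructor
  · intro h
    have hle : cyclePartition (p * g) ≤ cyclePartition p ⊔ cyclePartition g :=
      cyclePartition_le_iff.2 fun x =>
        Setoid.trans' _ (sup_rel_right p g x) (sup_rel_left p g (g x))
    exact hle h
  · intro h
    -- Conjugation by `g` inverts `p * g`, and `g a` lies in the cycle of `a` because `p` fixes `a`.
    -- So `g` reflects this cycle onto itself, and then so does `p`.
    have hinv : g * (p * g) * g⁻¹ = (p * g)⁻¹ := by
      rw [mul_inv_rev, inv_eq_self_of_involutive hp, inv_eq_self_of_involutive hg, mul_assoc,
        mul_assoc, mul_self_eq_one_of_involutive hg, mul_one]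
    have hga : g a = (p * g)⁻¹ a := by
      rw [mul_inv_rev, inv_eq_self_of_involutive hp, inv_eq_self_of_involutive hg,
        Perm.mul_apply, ha]
    have hG : ∀ y, (p * g).SameCycle a y → (p * g).SameCycle a (g y) := by
      rintro _ ⟨k, rfl⟩
      have h1 : g (((p * g) ^ k) a) = ((g * (p * g) * g⁻¹) ^ k) (g a) := by
        rw [conj_zpow]; simp
      rw [h1, hinv, hga, ← Perm.mul_apply, ← zpow_neg_one, ← zpow_mul, ← zpow_add]
      exact ⟨_, rfl⟩
    have hP : ∀ y, (p * g).SameCycle a y → (p * g).SameCycle a (p y) := by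
      intro y hy
      have h1 := hG y hy
      have h2 : (p * g).SameCycle (g y) (p y) := ⟨1, by simp [hg]⟩
      exact h1.trans h2
    have hle : cyclePartition p ⊔ cyclePartition g ≤
        Setoid.ker (fun y => (p * g).SameCycle a y) := by
      refine sup_le (cyclePartition_le_iff.2 fun x => ?_) (cyclePartition_le_iff.2 fun x => ?_)
      · exact propext ⟨hP x, fun h => by simpa [hp] using hP _ h⟩
      · exact propext ⟨hG x, fun h => by simpa [hg] using hG _ h⟩
    have h3 : (p * g).SameCycle a a = (p * g).SameCycle a b := hle h
    exact h3 ▸ Perm.SameCycle.refl _ _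

theorem cyclePartition_rel_iff {α : Type*} {g : Perm α} (hg : ∀ x, g (g x) = x) {x y : α} :
    cyclePartition g x y ↔ y = x ∨ y = g x := by
  constructor
  · intro hxy
    have hle : cyclePartition g ≤ Setoid.ker (fun y => y = x ∨ y = g x) := by
      refine cyclePartition_le_iff.2 fun z => propext ?_
      constructor
      · rintro (rfl | rfl)
        · exact Or.inr rfl
        · exact Or.inl (hg _)
      · rintro (h | h)
        · right; rw [← h, hg]
        · left; exact g.injective h
    have h3 : (x = x ∨ x = g x) = (y = x ∨ y = g x) := hle hxy
    exact h3 ▸ Or.inl rfl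
  · rintro (rfl | rfl)
    · exact Setoid.refl' _ _
    · exact cyclePartition_rel_apply g x

theorem two_mul_numBlocks_of_involutive {α : Type*} [Fintype α] [DecidableEq α] {g : Perm α}
    (hg : ∀ x, g (g x) = x) :
    2 * numBlocks (cyclePartition g) + g.support.card = 2 * Fintype.card α := by
  classical
  have h := mul_numBlocks_eq (cyclePartition g) (fun y => 1 + if g y = y then 1 else 0) 2
    (fun x => ?_)
  · have h1 : (Finset.univ.filter fun y => g y = y) = g.supportᶜ := by ext y; simp
    rw [h, Finset.sum_add_distrib, ← Finset.card_filter, h1, Finset.card_compl]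
    have := Finset.card_le_univ g.support
    simp only [Finset.sum_const, Finset.card_univ, smul_eq_mul, mul_one]
    omega
  · have : (Finset.univ.filter fun y => cyclePartition g x y) = {x, g x} := by
      ext y; simp [cyclePartition_rel_iff hg]
    rw [this]
    by_cases hx : g x = x
    · simp [hx]
    · rw [Finset.sum_pair (Ne.symm hx), hg]
      simp [hx, Ne.symm hx]

theorem support_card_of_ne {α : Type*} [Fintype α] [DecidableEq α] {g : Perm α}
    (hg' : ∀ x, g x ≠ x) : g.support.card = Fintype.card α := by
  rw [Finset.card_eq_iff_eq_univ, Finset.eq_univ_iff_forall]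
  exact fun x => Perm.mem_support.2 (hg' x)

/-- The blocks of the join of two involutions (one without fixed points) versus the cycles of
their product. -/
theorem four_mul_numBlocks_sup {α : Type*} [Fintype α] [DecidableEq α] {p g : Perm α}
    (hp : ∀ x, p (p x) = x) (hg : ∀ x, g (g x) = x) (hg' : ∀ x, g x ≠ x) :
    4 * numBlocks (cyclePartition p ⊔ cyclePartition g) + p.support.card =
      2 * numBlocks (cyclePartition (p * g)) + Fintype.card α := by
  induction hm : p.support.card using Nat.strong_induction_on generalizing p with
  | _ m ih =>
  by_cases hp1 : p = 1
  · subst hp1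
    have h1 : cyclePartition (1 : Perm α) ⊔ cyclePartition g = cyclePartition g :=
      sup_eq_right.2 (cyclePartition_le_iff.2 fun x => Setoid.refl' _ _)
    have h2 := two_mul_numBlocks_of_involutive hg
    rw [support_card_of_ne hg'] at h2
    rw [h1, one_mul, ← hm]
    simp only [Perm.support_one, Finset.card_empty]
    omega
  obtain ⟨a, ha⟩ : ∃ x, p x ≠ x := by
    by_contra! hc
    exact hp1 (Perm.ext hc)
  -- Induction on the number of matched pairs: `p'` is `p` with the pair `a, b` unmatched. Restoring
  -- the pair either splits a cycle inside one block or merges two cycles and two blocks, and the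
  -- identity is preserved in both cases.
  set b := p a with hb
  set p' := swap a b * p with hp'
  have hpb : p b = a := hp a
  have hpp : p = swap a b * p' := by rw [hp', swap_mul_self_mul]
  have ha' : p' a = a := by simp [hp', ← hb]
  have hb' : p' b = b := by simp [hp', hpb]
  have hother : ∀ x, x ≠ a → x ≠ b → p' x = p x := by
    intro x hxa hxb
    rw [hp', Perm.mul_apply, swap_apply_of_ne_of_ne]
    · exact fun h => hxb (by rw [hb, ← h, hp])
    · exact fun h => hxa (p.injective (h.trans hb))
  have hpinv : ∀ x, p' (p' x) = x := by
    intro x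
    rcases eq_or_ne x a with rfl | hxa
    · rw [ha', ha']
    rcases eq_or_ne x b with rfl | hxb
    · rw [hb', hb']
    rw [hother x hxa hxb, hother, hp]
    · exact fun h => hxb (by rw [hb, ← h, hp])
    · exact fun h => hxa (p.injective (h.trans hb))
  have hsupp : p.support.card = p'.support.card + 2 := by
    have hdis : (swap a b).Disjoint p' := by
      intro x
      rcases eq_or_ne x a with rfl | hxa
      · exact Or.inr ha'
      rcases eq_or_ne x b with rfl | hxb
      · exact Or.inr hb'
      exact Or.inl (swap_apply_of_ne_of_ne hxa hxb)
    have := hdis.card_support_mul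
    rw [← hpp, Perm.card_support_swap ha.symm] at this
    omega
  have ih' := ih _ (by omega) hpinv rfl
  have hJ : cyclePartition p ⊔ cyclePartition g =
      cyclePartition p' ⊔ cyclePartition g ⊔ cyclePartition (swap a b) := by
    apply le_antisymm
    · refine sup_le ?_ (le_sup_right.trans le_sup_left)
      conv_lhs => rw [hpp]
      exact (swap_mul_le_sup _ _).trans (sup_le_sup_right le_sup_left _)
    · have hsw : cyclePartition (swap a b) ≤ cyclePartition p := by
        refine cyclePartition_le_iff.2 fun y => ?_
        rcases eq_or_ne y a with rfl | hy
        · rw [swap_apply_left]; exact cyclePartition_rel_apply p _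
        rcases eq_or_ne y b with rfl | hy'
        · rw [swap_apply_right]; exact Setoid.symm' _ (cyclePartition_rel_apply p _)
        rw [swap_apply_of_ne_of_ne hy hy']
      refine sup_le (sup_le ?_ le_sup_right) (hsw.trans le_sup_left)
      exact ((swap_mul_le_sup _ _).trans (sup_le le_rfl hsw)).trans le_sup_left
  have hsc := sameCycle_mul_iff_sup hpinv hg (b := b) ha'
  rw [show p * g = swap a b * (p' * g) by rw [← mul_assoc, ← hpp], hJ]
  by_cases hab : (cyclePartition p' ⊔ cyclePartition g) a b
  · have h1 := numBlocks_swap_mul_of_sameCycle ha.symm (hsc.2 hab)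
    have h2 : cyclePartition p' ⊔ cyclePartition g ⊔ cyclePartition (swap a b) =
        cyclePartition p' ⊔ cyclePartition g := by
      refine sup_eq_left.2 (cyclePartition_le_iff.2 fun y => ?_)
      rcases eq_or_ne y a with rfl | hy
      · rw [swap_apply_left]; exact hab
      rcases eq_or_ne y b with rfl | hy'
      · rw [swap_apply_right]; exact Setoid.symm' _ hab
      rw [swap_apply_of_ne_of_ne hy hy']
    rw [h2]
    omega
  · have h1 := numBlocks_swap_mul_of_not_sameCycle (fun h => hab (hsc.1 h))
    have h2 := numBlocks_le_sup_swap (cyclePartition p' ⊔ cyclePartition g) a b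
    have h3 : cyclePartition p' ⊔ cyclePartition g <
        cyclePartition p' ⊔ cyclePartition g ⊔ cyclePartition (swap a b) := by
      refine lt_of_le_of_ne le_sup_left fun h => hab ?_
      rw [h]
      have := sup_rel_right (1 : Perm α) (swap a b) a
      rw [swap_apply_left] at this
      exact (sup_le (cyclePartition_le_iff.2 fun x => Setoid.refl' _ _) le_sup_right :
        cyclePartition (1 : Perm α) ⊔ cyclePartition (swap a b) ≤ _) this
    have h4 := numBlocks_strictAnti h3
    omega

/-! ### The two pairings of neighbouring points -/

theorem inv_apply_apply {α : Type*} (c : Perm α) (x : α) : c⁻¹ (c x) = x := c.symm_apply_apply x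

theorem conj_apply_apply {α : Type*} (c p : Perm α) (x : α) : (c * p * c⁻¹) (c x) = c (p x) := by
  rw [Perm.mul_apply, Perm.mul_apply, inv_apply_apply]

theorem val_finRotate {N : ℕ} (x : Fin N) :
    (finRotate N x).1 = if x.1 + 1 = N then 0 else x.1 + 1 := by
  cases N with
  | zero => exact x.elim0
  | succ N =>
    rw [coe_finRotate]
    simp only [Fin.ext_iff, Fin.val_last, Nat.add_right_cancel_iff]

theorem val_finRotate_pow {N : ℕ} (j : ℕ) (x : Fin N) :
    ((finRotate N ^ j) x).1 = (x.1 + j) % N := by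
  induction j with
  | zero => simp [Nat.mod_eq_of_lt x.2]
  | succ j ih =>
    rw [pow_succ', Perm.mul_apply, val_finRotate, ih, ← add_assoc]
    have hN : 0 < N := x.pos
    have h1 := Nat.mod_lt (x.1 + j) hN
    conv_rhs => rw [← Nat.div_add_mod (x.1 + j) N, add_assoc, Nat.mul_add_mod]
    split_ifs with h
    · rw [h, Nat.mod_self]
    · exact (Nat.mod_eq_of_lt (by omega)).symm

theorem val_gB {n : ℕ} (x : Fin (2 * n)) :
    (gB n x).1 = if x.1 % 2 = 0 then x.1 + 1 else x.1 - 1 := by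
  change (dite _ _ _ : Fin (2 * n)).1 = _
  split_ifs <;> rfl

theorem gB_gB {n : ℕ} (x : Fin (2 * n)) : gB n (gB n x) = x := by
  ext; simp only [val_gB]; split_ifs <;> omega

theorem gB_ne {n : ℕ} (x : Fin (2 * n)) : gB n x ≠ x := by
  intro h
  have := congrArg Fin.val h
  simp only [val_gB] at this; split_ifs at this <;> omega

theorem gA_finRotate {n : ℕ} (x : Fin (2 * n)) :
    gA n (finRotate (2 * n) x) = finRotate (2 * n) (gB n x) := by
  rw [gA, Perm.mul_apply, Perm.mul_apply, inv_apply_apply]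

theorem gA_gA {n : ℕ} (x : Fin (2 * n)) : gA n (gA n x) = x := by
  obtain ⟨y, rfl⟩ := (finRotate (2 * n)).surjective x
  rw [gA_finRotate, gA_finRotate, gB_gB]

theorem gA_ne {n : ℕ} (x : Fin (2 * n)) : gA n x ≠ x := by
  obtain ⟨y, rfl⟩ := (finRotate (2 * n)).surjective x
  rw [gA_finRotate]
  exact fun h => gB_ne y ((finRotate (2 * n)).injective h)

theorem val_gA {n : ℕ} (x : Fin (2 * n)) :
    (gA n x).1 = if x.1 % 2 = 1 then (if x.1 + 1 = 2 * n then 0 else x.1 + 1)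
      else (if x.1 = 0 then 2 * n - 1 else x.1 - 1) := by
  obtain ⟨y, rfl⟩ := (finRotate (2 * n)).surjective x
  rw [gA_finRotate]
  simp only [val_finRotate, val_gB]
  have := y.2
  split_ifs <;> first | contradiction | omega

theorem finRotate_conj_gA (n : ℕ) :
    finRotate (2 * n) * gA n * (finRotate (2 * n))⁻¹ = gB n := by
  rw [mul_inv_eq_iff_eq_mul]
  ext x
  simp only [Perm.mul_apply, val_finRotate, val_gB, val_gA]
  have := x.2
  split_ifs <;> omega

theorem finRotate_eq_or {n : ℕ} (x : Fin (2 * n)) :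
    finRotate (2 * n) x = gA n x ∨ finRotate (2 * n) x = gB n x := by
  simp only [Fin.ext_iff, val_finRotate, val_gB, val_gA]
  have := x.2
  split_ifs <;> omega

/-- Of two points paired by `gB n`, one is the cyclic successor of the other; `y` is the earlier
one. -/
theorem eq_finRotate_of_eq_gB {n : ℕ} {p : Perm (Fin (2 * n))} (hp : ∀ x, p (p x) = x)
    {x : Fin (2 * n)} (h : p x = gB n x) : ∃ y, p y = finRotate (2 * n) y := by
  have h2 : p (gB n x) = x := by rw [← h, hp]
  by_cases hx : x.1 % 2 = 0
  · refine ⟨x, h.trans ?_⟩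
    ext; simp only [val_finRotate, val_gB]
    have := x.2
    split_ifs <;> omega
  · refine ⟨gB n x, h2.trans ?_⟩
    ext; simp only [val_finRotate, val_gB]
    have := x.2
    split_ifs <;> omega

theorem eq_finRotate_of_eq_gA {n : ℕ} {p : Perm (Fin (2 * n))} (hp : ∀ x, p (p x) = x)
    {x : Fin (2 * n)} (h : p x = gA n x) : ∃ y, p y = finRotate (2 * n) y := by
  have h2 : p (gA n x) = x := by rw [← h, hp]
  by_cases hx : x.1 % 2 = 1
  · refine ⟨x, h.trans ?_⟩
    ext; simp only [val_finRotate, val_gA]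
    rw [if_pos hx]
  · refine ⟨gA n x, h2.trans ?_⟩
    ext; simp only [val_finRotate, val_gA]
    have := x.2
    split_ifs <;> omega

/-! ### Non-crossing partial matchings of the circle -/

/-- A partial matching of points on a circle (given as an involution) whose chords do not cross,
do not separate the unmatched points, and join points of opposite parity. -/
structure IsCyclicNC {N : ℕ} (p : Perm (Fin N)) : Prop where
  chord : ∀ a x, CyclicBetween a x (p a) → CyclicBetween a (p x) (p a)
  fixed : ∀ a x y, p x = x → p y = y → CyclicBetween a x (p a) → ¬ CyclicBetween (p a) y a
  parity : ∀ a, p a ≠ a → (p a).1 % 2 ≠ a.1 % 2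

theorem cyclicBetween_finRotate {N : ℕ} {a b c : Fin N} :
    CyclicBetween (finRotate N a) (finRotate N b) (finRotate N c) ↔ CyclicBetween a b c := by
  simp only [CyclicBetween, Fin.lt_def, val_finRotate]
  have := a.2
  have := b.2
  have := c.2
  split_ifs <;> omega

theorem IsCyclicNC.of_finRotate {n : ℕ} {p : Perm (Fin (2 * n))}
    (h : IsCyclicNC (finRotate (2 * n) * p * (finRotate (2 * n))⁻¹)) : IsCyclicNC p := by
  set c := finRotate (2 * n) with hc
  have e : ∀ x, (c * p * c⁻¹) (c x) = c (p x) := conj_apply_apply c p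
  refine ⟨fun a x hx => ?_, fun a x y hx hy hax hay => ?_, fun a ha => ?_⟩
  · have := h.chord (c a) (c x)
    rw [e, e, cyclicBetween_finRotate, cyclicBetween_finRotate] at this
    exact this hx
  · have := h.fixed (c a) (c x) (c y)
    rw [e, e, e, cyclicBetween_finRotate, cyclicBetween_finRotate, hx, hy] at this
    exact this rfl rfl hax hay
  · have := h.parity (c a)
    rw [e, hc, val_finRotate, val_finRotate] at this
    have h2 := this fun h3 => ha (c.injective h3)
    have := a.2
    have := (p a).2
    split_ifs at h2 <;> omega

/-! ### Region counts and extremal matchings -/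

/-- The number of black and white regions cut out by a partial matching. -/
noncomputable def numRegions {n : ℕ} (p : Perm (Fin (2 * n))) : ℕ :=
  numBlocks (cyclePartition p ⊔ cyclePartition (gA n)) +
    numBlocks (cyclePartition p ⊔ cyclePartition (gB n))

/-- Rotation by a single point exchanges `gA n` and `gB n`, so only the sum of the two counts is
invariant. -/
theorem numRegions_finRotate_conj {n : ℕ} (p : Perm (Fin (2 * n))) :
    numRegions (finRotate (2 * n) * p * (finRotate (2 * n))⁻¹) = numRegions p := by
  have h1 := numBlocks_sup_conj (finRotate (2 * n)) p (gA n)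
  have h2 := numBlocks_sup_conj (finRotate (2 * n)) p (gB n)
  rw [finRotate_conj_gA] at h1
  change numBlocks (_ ⊔ cyclePartition (gA n)) = _ at h2
  rw [numRegions, numRegions, h1, h2, add_comm]

/-- The number of regions is as large as a planar partial matching allows. -/
structure IsExtremal {n : ℕ} (p : Perm (Fin (2 * n))) : Prop where
  invol : ∀ x, p (p x) = x
  le : 4 * n ≤ 2 * numRegions p + p.support.card
  -- The bound `le` alone does not exclude crossings of perfect matchings: `(1 3)(2 4)` on four
  -- points attains it.
  le_of_ne : (∀ x, p x ≠ x) → 4 * n + 2 ≤ 2 * numRegions p + p.support.card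

theorem IsExtremal.finRotate {n : ℕ} {p : Perm (Fin (2 * n))} (h : IsExtremal p) :
    IsExtremal (finRotate (2 * n) * p * (finRotate (2 * n))⁻¹) := by
  refine ⟨fun x => ?_, ?_, fun h2 => ?_⟩
  · obtain ⟨y, rfl⟩ := (_root_.finRotate (2 * n)).surjective x
    rw [conj_apply_apply, conj_apply_apply, h.invol]
  · rw [numRegions_finRotate_conj, Perm.card_support_conj]; exact h.le
  · rw [numRegions_finRotate_conj, Perm.card_support_conj]
    refine h.le_of_ne fun x hx => h2 (_root_.finRotate (2 * n) x) ?_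
    rw [conj_apply_apply, hx]

/-- Weigh fixed points of `p` by 2 and the others by 1. If `p` and `g` share no pair, a moved `x`
brings the four points `x, g x, p x, g (p x)` into its block, and a block `{x, g x}` of fixed points
weighs 4 as well. So every block weighs at least 4, and more if it contains both fixed and moved
points. -/
theorem four_mul_numBlocks_sup_le {α : Type*} [Fintype α] [DecidableEq α] {p g : Perm α}
    (hg : ∀ x, g (g x) = x) (hg' : ∀ x, g x ≠ x)
    (hne : ∀ x, p x ≠ g x) :
    4 * numBlocks (cyclePartition p ⊔ cyclePartition g) + p.support.card ≤
      2 * Fintype.card α ∧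
    (2 * Fintype.card α ≤
      4 * numBlocks (cyclePartition p ⊔ cyclePartition g) + p.support.card →
      ∀ x, p x = x → p (g x) = g x) := by
  classical
  set S := cyclePartition p ⊔ cyclePartition g with hS
  let w : α → ℕ := fun y => 1 + if p y = y then 1 else 0
  have hw : ∑ y, w y + p.support.card = 2 * Fintype.card α := by
    have h1 : p.supportᶜ = Finset.univ.filter fun y => p y = y := by
      ext y; simp
    have h2 : ∑ y, w y = Fintype.card α + (p.supportᶜ).card := by
      simp [w, Finset.sum_add_distrib, h1]
    rw [h2, Finset.card_compl]
    have := Finset.card_le_univ p.support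
    omega
  have hrp : ∀ x, S x (p x) := sup_rel_left p g
  have hrg : ∀ x, S x (g x) := sup_rel_right p g
  have hmoved : ∀ x, p x ≠ x → 4 + (∑ y with S x y ∧ p y = y, 1) ≤ ∑ y with S x y, w y := by
    intro x hx
    have h1 : ∑ y with S x y, w y =
        (Finset.univ.filter fun y => S x y).card + ∑ y with S x y ∧ p y = y, 1 := by
      simp only [w, Finset.sum_add_distrib]
      rw [Finset.card_eq_sum_ones, ← Finset.filter_filter,
        Finset.sum_filter (p := fun y => p y = y)]
    rw [h1]
    refine Nat.add_le_add_right ?_ _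
    have h4 : ({x, g x, p x, g (p x)} : Finset α).card = 4 := by
      have e1 : x ≠ g x := (hg' x).symm
      have e2 : x ≠ p x := hx.symm
      have e3 : x ≠ g (p x) := fun h => hne x (by rw [← hg (p x), ← h])
      have e4 : g x ≠ p x := (hne x).symm
      have e5 : g x ≠ g (p x) := fun h => hx (g.injective h).symm
      have e6 : p x ≠ g (p x) := (hg' _).symm
      simp [e1, e2, e3, e4, e5, e6]
    rw [← h4]
    refine Finset.card_le_card fun y hy => ?_
    simp only [Finset.mem_insert, Finset.mem_singleton] at hy
    refine Finset.mem_filter.2 ⟨Finset.mem_univ _, ?_⟩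
    rcases hy with rfl | rfl | rfl | rfl
    · exact S.refl' _
    · exact hrg x
    · exact hrp x
    · exact S.trans' (hrp x) (hrg _)
  have hblock : ∀ x, 4 ≤ ∑ y with S x y, w y := by
    intro x
    by_cases hx : p x = x
    · by_cases hgx : p (g x) = g x
      · have hsub : ({x, g x} : Finset α) ⊆ Finset.univ.filter fun y => S x y := by
          intro y hy
          simp only [Finset.mem_insert, Finset.mem_singleton] at hy
          refine Finset.mem_filter.2 ⟨Finset.mem_univ _, ?_⟩
          rcases hy with rfl | rfl
          · exact S.refl' _
          · exact hrg x
        refine le_trans ?_ (Finset.sum_le_sum_of_subset hsub)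
        rw [Finset.sum_pair (hg' x).symm]
        simp [w, hx, hgx]
      · have h1 := hmoved _ hgx
        have h2 : ∀ y, S (g x) y ↔ S x y :=
          fun y => ⟨fun h => S.trans' (hrg x) h, fun h => S.trans' (S.symm' (hrg x)) h⟩
        simp only [h2] at h1
        omega
    · have := hmoved x hx
      omega
  have hle := mul_numBlocks_le S w 4 hblock
  refine ⟨by omega, fun heq x hx => ?_⟩
  by_contra hgx
  have h1 := sum_block_eq S w 4 hblock (by omega) (g x)
  have h2 := hmoved _ hgx
  have h3 : 0 < ∑ y with S (g x) y ∧ p y = y, 1 := by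
    rw [← Finset.card_eq_sum_ones, Finset.card_pos]
    exact ⟨x, Finset.mem_filter.2 ⟨Finset.mem_univ _, S.symm' (hrg x), hx⟩⟩
  omega

theorem isCyclicNC_one {N : ℕ} : IsCyclicNC (1 : Perm (Fin N)) := by
  refine ⟨fun a x hx => ?_, fun a x y hx hy hax hay => ?_, fun a ha => absurd rfl ha⟩
  · exact hx
  · simp only [CyclicBetween, Fin.lt_def, Perm.one_apply] at hax
    omega

theorem exists_finRotate_pow {N : ℕ} (x y : Fin N) : ∃ j, (finRotate N ^ j) x = y := by
  refine ⟨y.1 + (N - x.1), Fin.ext ?_⟩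
  rw [val_finRotate_pow, show x.1 + (y.1 + (N - x.1)) = y.1 + N by have := x.2; omega,
    Nat.add_mod_right, Nat.mod_eq_of_lt y.2]

/-- The weight bounds for `gA n` and `gB n` add up to `2 * numRegions p + p.support.card ≤ 4 * n`.
Extremality then forces a fixed point and equality in both bounds, so the fixed points are closed
under `gA n` and `gB n`, hence under passing to the next point. -/
theorem IsExtremal.eq_one_of_not_adjacent {n : ℕ} {p : Perm (Fin (2 * n))} (h : IsExtremal p)
    (hadj : ∀ x, p x ≠ _root_.finRotate (2 * n) x) : p = 1 := by
  have hA := four_mul_numBlocks_sup_le gA_gA gA_ne fun x hx =>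
    (eq_finRotate_of_eq_gA h.invol hx).elim fun y => hadj y
  have hB := four_mul_numBlocks_sup_le gB_gB gB_ne fun x hx =>
    (eq_finRotate_of_eq_gB h.invol hx).elim fun y => hadj y
  rw [Fintype.card_fin] at hA hB
  have hle := h.le
  have hle2 := h.le_of_ne
  rw [numRegions] at hle hle2
  obtain ⟨x, hx⟩ : ∃ x, p x = x := by
    by_contra! hc
    have := hle2 hc
    omega
  have hcA := hA.2 (by omega)
  have hcB := hB.2 (by omega)
  have hrot : ∀ j : ℕ, p ((_root_.finRotate (2 * n) ^ j) x) = (_root_.finRotate (2 * n) ^ j) x := by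
    intro j
    induction j with
    | zero => simpa using hx
    | succ j ih =>
      rw [pow_succ', Perm.mul_apply]
      rcases finRotate_eq_or ((_root_.finRotate (2 * n) ^ j) x) with e | e
      · rw [e]; exact hcA _ ih
      · rw [e]; exact hcB _ ih
  ext y
  obtain ⟨j, rfl⟩ := exists_finRotate_pow x y
  rw [hrot, Perm.one_apply]

/-! ### Induction by removing a pair of neighbours -/

/-- Removing a matched pair consisting of the last two points. -/
theorem exists_remove_pair {m : ℕ} {p : Perm (Fin (2 * (m + 1)))} (hp : ∀ x, p (p x) = x)
    (hl : ∀ x, x.1 = 2 * m → (p x).1 = 2 * m + 1) :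
    ∃ p' : Perm (Fin (2 * m)), (∀ x, p' (p' x) = x) ∧
      ∀ x, Fin.castLE (by omega) (p' x) = p (Fin.castLE (by omega) x) := by
  have hl1 : p ⟨2 * m, by omega⟩ = ⟨2 * m + 1, by omega⟩ := Fin.ext (hl _ rfl)
  have hl2 : p ⟨2 * m + 1, by omega⟩ = ⟨2 * m, by omega⟩ := by rw [← hl1, hp]
  have hlt : ∀ x : Fin (2 * m),
      (p (Fin.castLE (show 2 * m ≤ 2 * (m + 1) by omega) x)).1 < 2 * m := by
    intro x
    have h1 := hp (Fin.castLE (show 2 * m ≤ 2 * (m + 1) by omega) x)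
    by_contra hc
    have h2 := (p (Fin.castLE (show 2 * m ≤ 2 * (m + 1) by omega) x)).2
    have hx := x.2
    rcases (by omega : (p (Fin.castLE (show 2 * m ≤ 2 * (m + 1) by omega) x)).1 = 2 * m ∨
      (p (Fin.castLE (show 2 * m ≤ 2 * (m + 1) by omega) x)).1 = 2 * m + 1) with h3 | h3
    · rw [show p (Fin.castLE (show 2 * m ≤ 2 * (m + 1) by omega) x) = ⟨2 * m, by omega⟩ from
        Fin.ext h3, hl1] at h1
      have := congrArg Fin.val h1
      simp at this
      omega
    · rw [show p (Fin.castLE (show 2 * m ≤ 2 * (m + 1) by omega) x) = ⟨2 * m + 1, by omega⟩ from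
        Fin.ext h3, hl2] at h1
      have := congrArg Fin.val h1
      simp at this
      omega
  have hinv : Function.Involutive fun x : Fin (2 * m) => (⟨_, hlt x⟩ : Fin (2 * m)) := by
    intro x
    have h1 := congrArg Fin.val (hp (Fin.castLE (show 2 * m ≤ 2 * (m + 1) by omega) x))
    exact Fin.ext h1
  exact ⟨hinv.toPerm _, hinv, fun x => rfl⟩

theorem IsCyclicNC.of_remove_pair {m : ℕ} {p : Perm (Fin (2 * (m + 1)))}
    (hp : ∀ x, p (p x) = x) (hl : ∀ x, x.1 = 2 * m → (p x).1 = 2 * m + 1)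
    {p' : Perm (Fin (2 * m))}
    (hpp' : ∀ x, Fin.castLE (by omega) (p' x) = p (Fin.castLE (by omega) x))
    (h : IsCyclicNC p') : IsCyclicNC p := by
  have hl' : ∀ x, x.1 = 2 * m + 1 → (p x).1 = 2 * m := by
    intro x hx
    have h1 : p ⟨2 * m, by omega⟩ = x := Fin.ext ((hl _ rfl).trans hx.symm)
    rw [← h1, hp]
  have hcase : ∀ x : Fin (2 * (m + 1)),
      (∃ y : Fin (2 * m), y.1 = x.1 ∧ (p' y).1 = (p x).1) ∨
      (x.1 = 2 * m ∧ (p x).1 = 2 * m + 1) ∨ (x.1 = 2 * m + 1 ∧ (p x).1 = 2 * m) := by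
    intro x
    have hx := x.2
    by_cases h1 : x.1 < 2 * m
    · exact Or.inl ⟨⟨x.1, h1⟩, rfl, congrArg Fin.val (hpp' ⟨x.1, h1⟩)⟩
    · rcases (by omega : x.1 = 2 * m ∨ x.1 = 2 * m + 1) with h2 | h2
      · exact Or.inr (Or.inl ⟨h2, hl _ h2⟩)
      · exact Or.inr (Or.inr ⟨h2, hl' _ h2⟩)
  refine ⟨fun a x => ?_, fun a x y hx hy => ?_, fun a ha => ?_⟩
  · rcases hcase a with ⟨a', e1, e2⟩ | ha | ha
    · rcases hcase x with ⟨x', e3, e4⟩ | hx | hx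
      · have := h.chord a' x'
        simpa only [CyclicBetween, Fin.lt_def, e1, e2, e3, e4] using this
      all_goals
        simp only [CyclicBetween, Fin.lt_def]
        have := a'.2
        have := (p' a').2
        omega
    all_goals
      rcases hcase x with ⟨x', e3, e4⟩ | hx | hx
      all_goals
        simp only [CyclicBetween, Fin.lt_def]
        omega
  · rcases hcase x with ⟨x', e3, e4⟩ | hx' | hx'
    rotate_left
    · rw [hx] at hx'; omega
    · rw [hx] at hx'; omega
    rcases hcase y with ⟨y', e5, e6⟩ | hy' | hy'
    rotate_left
    · rw [hy] at hy'; omega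
    · rw [hy] at hy'; omega
    rcases hcase a with ⟨a', e1, e2⟩ | ha | ha
    · have := h.fixed a' x' y' (Fin.ext (by rw [e4, hx, e3])) (Fin.ext (by rw [e6, hy, e5]))
      simpa only [CyclicBetween, Fin.lt_def, e1, e2, e3, e5] using this
    all_goals
      simp only [CyclicBetween, Fin.lt_def]
      omega
  · rcases hcase a with ⟨a', e1, e2⟩ | ha | ha
    · have := h.parity a' fun h2 => ha (Fin.ext (by rw [← e1, ← e2, h2]))
      rwa [e1, e2] at this
    all_goals omega

/-- The removed pair is itself a pair of `gB (m + 1)`, so on that side exactly its own block can be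
lost. On the other side it is an inner piece of the path `2m-1, 2m, 2m+1, 0`, which contracts to the
pair `{2m-1, 0}` of `gA m`; no block is lost. -/
theorem numRegions_le_of_remove_pair {m : ℕ} (hm : 1 ≤ m) {p : Perm (Fin (2 * (m + 1)))}
    (hl : ∀ x, x.1 = 2 * m → (p x).1 = 2 * m + 1) {p' : Perm (Fin (2 * m))}
    (hpp' : ∀ x, Fin.castLE (by omega) (p' x) = p (Fin.castLE (by omega) x)) :
    numRegions p ≤ numRegions p' + 1 := by
  have hι : 2 * m ≤ 2 * (m + 1) := by omega
  have hl1 : p ⟨2 * m, by omega⟩ = ⟨2 * m + 1, by omega⟩ := Fin.ext (hl _ rfl)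
  have hA : numBlocks (cyclePartition p ⊔ cyclePartition (gA (m + 1))) ≤
      numBlocks (cyclePartition p' ⊔ cyclePartition (gA m)) := by
    set S := cyclePartition p ⊔ cyclePartition (gA (m + 1)) with hS
    have hrp : ∀ x, S x (p x) := sup_rel_left _ _
    have hrg : ∀ x, S x (gA (m + 1) x) := sup_rel_right _ _
    have r1 : S ⟨2 * m, by omega⟩ ⟨2 * m + 1, by omega⟩ := hl1 ▸ hrp _
    have r2 : S ⟨2 * m, by omega⟩ ⟨2 * m - 1, by omega⟩ := by
      convert hrg _ using 1
      ext; simp only [val_gA]; split_ifs <;> omega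
    have r3 : S ⟨2 * m + 1, by omega⟩ ⟨0, by omega⟩ := by
      convert hrg _ using 1
      ext; simp only [val_gA]; split_ifs <;> omega
    have r4 : S ⟨0, by omega⟩ ⟨2 * m - 1, by omega⟩ :=
      S.trans' (S.symm' r3) (S.trans' (S.symm' r1) r2)
    refine numBlocks_le_of_map (Fin.castLE hι) (sup_le ?_ ?_) fun y => ?_
    · refine cyclePartition_le_iff.2 fun x => ?_
      change S _ _
      rw [hpp']
      exact hrp _
    · refine cyclePartition_le_iff.2 fun x => ?_
      change S _ _
      by_cases h0 : x.1 = 0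
      · convert r4 using 1
        · exact Fin.ext h0
        · ext; simp only [Fin.val_castLE, val_gA]; split_ifs <;> omega
      by_cases h1 : x.1 = 2 * m - 1
      · convert S.symm' r4 using 1
        · exact Fin.ext h1
        · ext; simp only [Fin.val_castLE, val_gA]; split_ifs <;> omega
      convert hrg _ using 1
      ext
      have := x.2
      simp only [Fin.val_castLE, val_gA]
      split_ifs <;> omega
    · have hy := y.2
      by_cases h1 : y.1 < 2 * m
      · exact ⟨⟨y.1, h1⟩, S.refl' _⟩
      refine ⟨⟨2 * m - 1, by omega⟩, ?_⟩
      rcases (by omega : y.1 = 2 * m ∨ y.1 = 2 * m + 1) with h2 | h2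
      · rw [show y = ⟨2 * m, by omega⟩ from Fin.ext h2]
        exact S.symm' r2
      · rw [show y = ⟨2 * m + 1, by omega⟩ from Fin.ext h2]
        exact S.trans' (S.symm' r2) r1
  have hB : numBlocks (cyclePartition p ⊔ cyclePartition (gB (m + 1))) ≤
      numBlocks (cyclePartition p' ⊔ cyclePartition (gB m)) + 1 := by
    set S := cyclePartition p ⊔ cyclePartition (gB (m + 1)) with hS
    have hrp : ∀ x, S x (p x) := sup_rel_left _ _
    have hrg : ∀ x, S x (gB (m + 1) x) := sup_rel_right _ _
    refine numBlocks_le_add_one_of_map (Fin.castLE hι) ⟨2 * m, by omega⟩ (sup_le ?_ ?_)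
      fun y => ?_
    · refine cyclePartition_le_iff.2 fun x => ?_
      change S _ _
      rw [hpp']
      exact hrp _
    · refine cyclePartition_le_iff.2 fun x => ?_
      change S _ _
      convert hrg _ using 1
      ext
      simp only [Fin.val_castLE, val_gB]
    · have hy := y.2
      by_cases h1 : y.1 < 2 * m
      · exact Or.inr ⟨⟨y.1, h1⟩, S.refl' _⟩
      left
      rcases (by omega : y.1 = 2 * m ∨ y.1 = 2 * m + 1) with h2 | h2
      · rw [show y = ⟨2 * m, by omega⟩ from Fin.ext h2]
      · rw [show y = ⟨2 * m + 1, by omega⟩ from Fin.ext h2]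
        exact hl1 ▸ hrp _
  rw [numRegions, numRegions]
  omega

theorem card_support_le_of_remove_pair {m : ℕ} {p : Perm (Fin (2 * (m + 1)))}
    {p' : Perm (Fin (2 * m))}
    (hpp' : ∀ x, Fin.castLE (by omega) (p' x) = p (Fin.castLE (by omega) x)) :
    p.support.card ≤ p'.support.card + 2 := by
  have hι : 2 * m ≤ 2 * (m + 1) := by omega
  have hsub : p.support ⊆ p'.support.map (Fin.castLEEmb hι) ∪
      {⟨2 * m, by omega⟩, ⟨2 * m + 1, by omega⟩} := by
    intro x hx
    rw [Perm.mem_support] at hx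
    simp only [Finset.mem_union, Finset.mem_map, Finset.mem_insert, Finset.mem_singleton]
    have hx2 := x.2
    by_cases h1 : x.1 < 2 * m
    · left
      refine ⟨⟨x.1, h1⟩, Perm.mem_support.2 fun h => hx ?_, rfl⟩
      have := hpp' ⟨x.1, h1⟩
      rw [h] at this
      exact this.symm
    · right
      rcases (by omega : x.1 = 2 * m ∨ x.1 = 2 * m + 1) with h2 | h2
      · exact Or.inl (Fin.ext h2)
      · exact Or.inr (Fin.ext h2)
  refine (Finset.card_le_card hsub).trans ((Finset.card_union_le _ _).trans ?_)
  rw [Finset.card_map]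
  exact Nat.add_le_add_left Finset.card_le_two _

theorem isCyclicNC_of_finRotate_pow {n : ℕ} {p : Perm (Fin (2 * n))} (j : ℕ)
    (h : IsCyclicNC (finRotate (2 * n) ^ j * p * (finRotate (2 * n) ^ j)⁻¹)) :
    IsCyclicNC p := by
  induction j with
  | zero => simpa using h
  | succ j ih =>
    refine ih (IsCyclicNC.of_finRotate ?_)
    convert h using 1
    rw [pow_succ']
    group

theorem IsExtremal.finRotate_pow {n : ℕ} {p : Perm (Fin (2 * n))} (h : IsExtremal p) (j : ℕ) :
    IsExtremal (_root_.finRotate (2 * n) ^ j * p * (_root_.finRotate (2 * n) ^ j)⁻¹) := by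
  induction j with
  | zero => simpa using h
  | succ j ih =>
    convert ih.finRotate using 1
    rw [pow_succ']
    group

/-- Removing a pair of neighbours costs at most one region and two moved points, which matches the
drop of 4 in `4 * n`. So the smaller matching is again extremal, and a chord between neighbours can
be put back without harm. -/
theorem IsExtremal.isCyclicNC {n : ℕ} {p : Perm (Fin (2 * n))} (h : IsExtremal p) :
    IsCyclicNC p := by
  induction n with
  | zero => exact ⟨fun a => a.elim0, fun a => a.elim0, fun a => a.elim0⟩
  | succ m ih =>
  rcases Nat.eq_zero_or_pos m with rfl | hm
  · refine ⟨fun a x => ?_, fun a x y hx hy => ?_, fun a ha => ?_⟩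
    · have := a.2
      have := x.2
      have := (p a).2
      simp only [CyclicBetween, Fin.lt_def]
      omega
    · have := a.2
      have := x.2
      have := (p a).2
      simp only [CyclicBetween, Fin.lt_def]
      omega
    · have := a.2
      have := (p a).2
      have : (p a).1 ≠ a.1 := fun h => ha (Fin.ext h)
      omega
  by_cases hadj : ∀ x, p x ≠ _root_.finRotate (2 * (m + 1)) x
  · rw [h.eq_one_of_not_adjacent hadj]
    exact isCyclicNC_one
  push Not at hadj
  obtain ⟨a, ha⟩ := hadj
  obtain ⟨j, hj⟩ := exists_finRotate_pow a ⟨2 * m, by omega⟩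
  refine isCyclicNC_of_finRotate_pow j ?_
  have hq := h.finRotate_pow j
  set q := _root_.finRotate (2 * (m + 1)) ^ j * p * (_root_.finRotate (2 * (m + 1)) ^ j)⁻¹
    with hqdef
  have hl : ∀ x, x.1 = 2 * m → (q x).1 = 2 * m + 1 := by
    intro x hx
    rw [show x = (_root_.finRotate (2 * (m + 1)) ^ j) a from
      (hj.trans (Fin.ext hx.symm)).symm, hqdef, conj_apply_apply, ha, ← Perm.mul_apply, ← pow_succ, pow_succ',
      Perm.mul_apply, hj, val_finRotate, if_neg]
    simp only
    omega
  obtain ⟨p', hp', hpp'⟩ := exists_remove_pair hq.invol hl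
  refine IsCyclicNC.of_remove_pair hq.invol hl hpp' (ih ⟨hp', ?_, fun hne => ?_⟩)
  · have h1 := numRegions_le_of_remove_pair hm hl hpp'
    have h2 := card_support_le_of_remove_pair hpp'
    have := hq.le
    omega
  · have h1 := numRegions_le_of_remove_pair hm hl hpp'
    have h2 := card_support_le_of_remove_pair hpp'
    have := hq.le_of_ne fun x hx => ?_
    · omega
    by_cases h3 : x.1 < 2 * m
    · refine hne ⟨x.1, h3⟩ (Fin.ext ?_)
      have := congrArg Fin.val (hpp' ⟨x.1, h3⟩)
      exact this.trans (congrArg Fin.val hx)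
    · have hx2 := x.2
      rcases (by omega : x.1 = 2 * m ∨ x.1 = 2 * m + 1) with h4 | h4
      · have := hl x h4
        rw [hx] at this
        omega
      · have h5 : q ⟨2 * m, by omega⟩ = x := Fin.ext ((hl _ rfl).trans h4.symm)
        have h6 := hq.invol ⟨2 * m, by omega⟩
        rw [h5, hx] at h6
        rw [h6] at h4
        simp only at h4
        omega

/-! ### From non-crossing matchings to non-crossing permutations -/

/-- The chords of an involution of points on a line do not cross. -/
def IsLinearNC {N : ℕ} (s : Perm (Fin N)) : Prop :=
  ∀ a b, a < b → b < s a → a < s b ∧ s b < s a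

/-- The points strictly under a chord are matched among themselves, so their number is even. -/
theorem IsLinearNC.parity {N : ℕ} {s : Perm (Fin N)} (h : IsLinearNC s)
    (hs : ∀ x, s (s x) = x) (hne : ∀ x, s x ≠ x) (a : Fin N) : (s a).1 % 2 ≠ a.1 % 2 := by
  suffices key : ∀ a, a < s a → (s a).1 % 2 ≠ a.1 % 2 by
    rcases lt_or_gt_of_ne (hne a) with h1 | h1
    · have := key (s a) (by rwa [hs])
      rw [hs] at this
      exact this.symm
    · exact key a h1
  intro a ha
  have hsum : ∑ _x ∈ Finset.Ioo a (s a), (1 : ZMod 2) = 0 := by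
    refine Finset.sum_involution (fun x _ => s x) (fun _ _ => by decide)
      (fun x _ _ => hne x) (fun x hx => ?_) (fun x _ => hs x)
    rw [Finset.mem_Ioo] at hx ⊢
    exact h a x hx.1 hx.2
  rw [Finset.sum_const, Fin.card_Ioo, nsmul_one, ZMod.natCast_eq_zero_iff] at hsum
  rw [Fin.lt_def] at ha
  omega

/-- Thickening: the point `i` becomes an incoming end `top i` followed by an outgoing end `bot i`,
and chords between opposite parities are the arrows from `i` to `k i`. -/
theorem exists_perm_top_bot {m : ℕ} {s : Perm (Fin (2 * m))} (hs : ∀ x, s (s x) = x)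
    (hpar : ∀ x, (s x).1 % 2 ≠ x.1 % 2) :
    ∃ k : Perm (Fin m), ∀ i, s (bot i) = top (k i) := by
  have h1 : ∀ i : Fin m, s (bot i) = top ⟨(s (bot i)).1 / 2, by have := (s (bot i)).2; omega⟩ := by
    intro i
    have := hpar (bot i)
    ext
    simp only [top, bot] at *
    omega
  have h2 : ∀ i : Fin m, s (top i) = bot ⟨(s (top i)).1 / 2, by have := (s (top i)).2; omega⟩ := by
    intro i
    have := hpar (top i)
    ext
    simp only [top, bot] at *
    omega
  refine ⟨⟨fun i => ⟨(s (bot i)).1 / 2, by have := (s (bot i)).2; omega⟩,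
    fun i => ⟨(s (top i)).1 / 2, by have := (s (top i)).2; omega⟩, fun i => ?_, fun i => ?_⟩,
    fun i => h1 i⟩
  · ext
    simp only
    rw [← h1, hs]
    simp only [bot]
    omega
  · ext
    simp only
    rw [← h2, hs]
    simp only [top]
    omega

theorem sameCycle_congr {α : Type*} {k : Perm α} {P : α → Prop} (hP : ∀ y, P y ↔ P (k y))
    {x y : α} (h : k.SameCycle x y) : P x ↔ P y := by
  have hle : cyclePartition k ≤ Setoid.ker P := cyclePartition_le_iff.2 fun z => propext (hP z)
  exact iff_of_eq (hle h)

theorem exists_enter {α : Type*} [Finite α] {k : Perm α} {I : α → Prop} {a c : α}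
    (h : k.SameCycle a c) (ha : ¬ I a) (hc : I c) : ∃ x, k.SameCycle a x ∧ ¬ I x ∧ I (k x) := by
  by_contra! hcon
  obtain ⟨j, -, rfl⟩ := h.exists_pow_eq'
  have key : ∀ j : ℕ, ¬ I ((k ^ j) a) := by
    intro j
    induction j with
    | zero => simpa using ha
    | succ j ih =>
      rw [pow_succ', Perm.mul_apply]
      exact hcon _ ⟨j, by simp⟩ ih
  exact key j hc

/-- The permutation whose thickening is a non-crossing matching is non-crossing. -/
theorem IsLinearNC.isNC {m : ℕ} {s : Perm (Fin (2 * m))} (h : IsLinearNC s)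
    (hs : ∀ x, s (s x) = x) {k : Perm (Fin m)} (hk : ∀ i, s (bot i) = top (k i)) : IsNC k := by
  have hin : ∀ a b, a < s a → (a < b ∧ b < s a ↔ a < s b ∧ s b < s a) := by
    intro a b _
    refine ⟨fun h1 => h a b h1.1 h1.2, fun h1 => ?_⟩
    have := h a (s b) h1.1 h1.2
    rwa [hs] at this
  -- An ascending arrow makes the open interval between its ends invariant under `k`; a descending
  -- one does so for the closed interval, since its chord runs outside both thickened points. Each
  -- cycle thus lies inside or outside every such interval.
  have hup : ∀ x, x < k x → ∀ y, x < y ∧ y < k x ↔ x < k y ∧ k y < k x := by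
    intro x hx y
    have := hin (bot x) (bot y)
    rw [hk, hk] at this
    simp only [Fin.lt_def, top, bot] at *
    omega
  have hdown : ∀ x, k x < x → ∀ y, k x ≤ y ∧ y ≤ x ↔ k x ≤ k y ∧ k y ≤ x := by
    intro x hx y
    have h1 := hin (top (k x)) (bot y)
    rw [← hk, hs, hk, hk] at h1
    have h2 : k y = k x ↔ y = x := k.injective.eq_iff
    simp only [Fin.lt_def, Fin.le_def, Fin.ext_iff, top, bot] at *
    omega
  constructor
  · intro x y hxy hb
    rcases hb with hb | hb | hb
    · exact lt_irrefl _ ((sameCycle_congr (hup x (hb.1.trans hb.2)) hxy).2 hb).1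
    · have := (sameCycle_congr (hdown x hb.2) hxy).1 ⟨hb.2.le, le_rfl⟩
      exact absurd this.1 (not_le.2 hb.1)
    · have := (sameCycle_congr (hdown x hb.1) hxy).1 ⟨hb.1.le, le_rfl⟩
      exact absurd this.2 (not_le.2 hb.2)
  · intro a b c d hab hbc hcd hac hbd
    by_contra hnab
    -- The cycle of `a` must enter the interval between `b` and `d` by some arrow. The invariant
    -- interval of that arrow contains exactly one of `b` and `d`, although these share a cycle.
    obtain ⟨x, hax, hx, hkx⟩ := exists_enter (I := fun z => b < z ∧ z < d) hac
      (fun h => lt_asymm hab h.1) ⟨hbc, hcd⟩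
    have hxb : x ≠ b := by rintro rfl; exact hnab hax
    have hxd : x ≠ d := by rintro rfl; exact hnab (hax.trans hbd.symm)
    rcases lt_or_gt_of_ne hxb with h1 | h1
    · have := (sameCycle_congr (hup x (h1.trans hkx.1)) hbd).1 ⟨h1, hkx.1⟩
      exact lt_asymm this.2 hkx.2
    · have h2 : d < x := lt_of_le_of_ne (not_lt.1 fun h => hx ⟨h1, h⟩) hxd.symm
      have := (sameCycle_congr (hdown x (hkx.2.trans h2)) hbd).2 ⟨hkx.2.le, h2.le⟩
      exact absurd this.1 (not_le.2 hkx.1)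

/-- Completing a partial matching by a rainbow connecting the unmatched points to additional
points at the end of the line. -/
theorem exists_rainbow {n d : ℕ} {p : Perm (Fin (2 * n))} (hp : ∀ x, p (p x) = x)
    (hnc : IsCyclicNC p) (hlast : ∀ w, p w = w → ∀ l : Fin (2 * n), l.1 + 1 = 2 * n → p l = l)
    (hcard : p.support.card + 2 * d = 2 * n) :
    ∃ s : Perm (Fin (2 * (n + d))), (∀ x, s (s x) = x) ∧ (∀ x, s x ≠ x) ∧ IsLinearNC s ∧
      (∀ (x : Fin (2 * n)) (z : Fin (2 * (n + d))), z.1 = x.1 →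
        (p x ≠ x → (s z).1 = (p x).1) ∧ (p x = x → 2 * n ≤ (s z).1) ∧
        (p x = x → x.1 + 1 = 2 * n → (s z).1 = 2 * n)) ∧
      (∀ z : Fin (2 * (n + d)), 2 * n ≤ z.1 → (s z).1 < 2 * n) := by
  classical
  set F : Finset (Fin (2 * n)) := Finset.univ.filter fun x => p x = x with hF
  have hFc : F.card = 2 * d := by
    have h1 : p.supportᶜ = F := by ext y; simp [hF]
    rw [← h1, Finset.card_compl, Fintype.card_fin]
    omega
  have hfix : ∀ j, p (F.orderEmbOfFin hFc j) = F.orderEmbOfFin hFc j := fun j =>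
    (Finset.mem_filter.1 (F.orderEmbOfFin_mem hFc j)).2
  have hsurj : ∀ x, p x = x → ∃ j, F.orderEmbOfFin hFc j = x := by
    intro x hx
    have : x ∈ Set.range (F.orderEmbOfFin hFc) := by
      rw [Finset.range_orderEmbOfFin]
      exact Finset.mem_filter.2 ⟨Finset.mem_univ _, hx⟩
    exact this
  have hmono : ∀ i j, (F.orderEmbOfFin hFc i).1 < (F.orderEmbOfFin hFc j).1 ↔ i.1 < j.1 :=
    fun i j => (F.orderEmbOfFin hFc).lt_iff_lt
  generalize F.orderEmbOfFin hFc = e at hfix hsurj hmono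
  -- Matched points keep their partner; the `j`-th unmatched point (from 0) is joined to the `j`-th
  -- position counted from the end, so the new chords are nested.
  have hex : ∀ z : Fin (2 * (n + d)), ∃ w : Fin (2 * (n + d)),
      (∃ y : Fin (2 * n), p y ≠ y ∧ z.1 = y.1 ∧ w.1 = (p y).1) ∨
      (∃ j, z.1 = (e j).1 ∧ w.1 = 2 * n + 2 * d - 1 - j.1) ∨
      (∃ j, z.1 = 2 * n + 2 * d - 1 - j.1 ∧ w.1 = (e j).1) := by
    intro z
    have hz := z.2
    by_cases h1 : z.1 < 2 * n
    · by_cases h2 : p ⟨z.1, h1⟩ = ⟨z.1, h1⟩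
      · obtain ⟨j, hj⟩ := hsurj _ h2
        have := j.2
        exact ⟨⟨2 * n + 2 * d - 1 - j.1, by omega⟩, Or.inr (Or.inl ⟨j, by rw [hj], rfl⟩)⟩
      · exact ⟨⟨(p ⟨z.1, h1⟩).1, by have := (p ⟨z.1, h1⟩).2; omega⟩,
          Or.inl ⟨⟨z.1, h1⟩, h2, rfl, rfl⟩⟩
    · refine ⟨⟨(e ⟨2 * n + 2 * d - 1 - z.1, by omega⟩).1, ?_⟩,
        Or.inr (Or.inr ⟨⟨2 * n + 2 * d - 1 - z.1, by omega⟩, ?_, rfl⟩)⟩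
      · have := (e ⟨2 * n + 2 * d - 1 - z.1, by omega⟩).2
        omega
      · simp only
        omega
  choose f hf using hex
  have hmov : ∀ y, p y ≠ y → ∀ j, (p y).1 ≠ (e j).1 ∧ y.1 ≠ (e j).1 := by
    intro y hy j
    constructor <;> intro h
    · have h2 : p y = e j := Fin.ext h
      have h3 := hfix j
      rw [← h2, hp] at h3
      exact hy h3.symm
    · exact hy ((Fin.ext h : y = e j) ▸ hfix j)
  have hinj : ∀ i j, (e i).1 = (e j).1 → i.1 = j.1 := by
    intro i j h
    have := hmono i j
    have := hmono j i
    omega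
  -- No unmatched point lies under a chord: the last point would then be unmatched too and lie on
  -- the other side of that chord.
  have harc : ∀ y w : Fin (2 * n), y.1 < w.1 → w.1 < (p y).1 →
      p w ≠ w ∧ y.1 < (p w).1 ∧ (p w).1 < (p y).1 := by
    intro y w h1 h2
    have hyn := (p y).2
    refine ⟨fun hw => ?_, ?_⟩
    · have hl := hlast w hw ⟨2 * n - 1, by omega⟩ (by simp only; omega)
      refine hnc.fixed y w _ hw hl (Or.inl ⟨h1, h2⟩) ?_
      have h3 : (p y).1 ≠ 2 * n - 1 := by
        intro h3
        have h4 : p y = ⟨2 * n - 1, by omega⟩ := Fin.ext h3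
        rw [← h4, hp] at hl
        rw [← hl] at h2
        omega
      simp only [CyclicBetween, Fin.lt_def]
      omega
    · have := hnc.chord y w (Or.inl ⟨h1, h2⟩)
      simp only [CyclicBetween, Fin.lt_def] at this
      omega
  have hinv : Function.Involutive f := by
    intro z
    ext
    rcases hf z with ⟨y, hy, h1, h2⟩ | ⟨j, h1, h2⟩ | ⟨j, h1, h2⟩ <;>
      rcases hf (f z) with ⟨y', hy', h3, h4⟩ | ⟨j', h3, h4⟩ | ⟨j', h3, h4⟩
    · rw [h4, h1, ← (Fin.ext (h2.symm.trans h3) : p y = y'), hp]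
    · exact absurd (h2.symm.trans h3) (hmov y hy j').1
    · have := (p y).2
      have := j'.2
      omega
    · have := j.2
      have := y'.2
      omega
    · have := j.2
      have := (e j').2
      omega
    · have := j.2
      have := j'.2
      rw [h4, h1, (Fin.ext (by omega) : j' = j)]
    · exact absurd (h3.symm.trans h2) (hmov y' hy' j).2
    · rw [h4, h1, hinj j' j (h3.symm.trans h2)]
    · have := (e j).2
      have := j'.2
      omega
  refine ⟨hinv.toPerm f, hinv, fun z => ?_, fun a b => ?_, fun x z hxz => ?_, fun z hz => ?_⟩
  · change f z ≠ z
    intro hz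
    have hz := congrArg Fin.val hz
    rcases hf z with ⟨y, hy, h1, h2⟩ | ⟨j, h1, h2⟩ | ⟨j, h1, h2⟩
    · exact hy (Fin.ext (by omega))
    · have := (e j).2
      have := j.2
      omega
    · have := (e j).2
      have := j.2
      omega
  · change a < b → b < f a → a < f b ∧ f b < f a
    simp only [Fin.lt_def]
    intro hab hba
    rcases hf a with ⟨y, hy, h1, h2⟩ | ⟨j, h1, h2⟩ | ⟨j, h1, h2⟩ <;>
      rcases hf b with ⟨y', hy', h3, h4⟩ | ⟨j', h3, h4⟩ | ⟨j', h3, h4⟩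
    · have := harc y y' (by omega) (by omega)
      omega
    · exact absurd (hfix j') (harc y (e j') (by omega) (by omega)).1
    · have := (p y).2
      have := j'.2
      omega
    · have h5 := (hmov y' hy' j).1
      have := (p y').2
      have := j.2
      refine ⟨?_, by omega⟩
      by_contra hc
      exact (harc (p y') (e j) (by omega) (by rw [hp]; omega)).1 (hfix j)
    · have := hmono j j'
      have := (e j).2
      have := j'.2
      omega
    · have := hmono j j'
      have := (e j').2
      have := j.2
      have := j'.2
      omega
    all_goals
      have := (e j).2
      have := j.2
      omega
  · change (p x ≠ x → (f z).1 = (p x).1) ∧ (p x = x → 2 * n ≤ (f z).1) ∧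
      (p x = x → x.1 + 1 = 2 * n → (f z).1 = 2 * n)
    have hx := x.2
    rcases hf z with ⟨y, hy, h1, h2⟩ | ⟨j, h1, h2⟩ | ⟨j, h1, h2⟩
    · obtain rfl : y = x := Fin.ext (by omega)
      exact ⟨fun _ => h2, fun h => absurd h hy, fun h => absurd h hy⟩
    · obtain rfl : e j = x := Fin.ext (by omega)
      have hj := j.2
      refine ⟨fun h => absurd (hfix j) h, fun _ => by omega, fun _ h3 => ?_⟩
      have : ¬ j.1 + 1 < 2 * d := by
        intro h4
        have := (hmono j ⟨j.1 + 1, h4⟩).2 (by simp only; omega)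
        have := (e ⟨j.1 + 1, h4⟩).2
        omega
      omega
    · have := j.2
      omega
  · change (f z).1 < 2 * n
    rcases hf z with ⟨y, hy, h1, h2⟩ | ⟨j, h1, h2⟩ | ⟨j, h1, h2⟩
    · have := y.2
      omega
    · have := (e j).2
      omega
    · have := (e j).2
      omega

/-! ### Partitions into pairs and singletons -/

theorem numSingletons_add_card_support {α : Type*} [Fintype α] [DecidableEq α] {p : Perm α}
    (hp : ∀ x, p (p x) = x) :
    numSingletons (cyclePartition p) + p.support.card = Fintype.card α := by
  have h1 : numSingletons (cyclePartition p) = (p.supportᶜ).card := by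
    classical
    rw [numSingletons, Nat.card_eq_fintype_card, Fintype.card_subtype]
    congr 1
    ext x
    simp only [cyclePartition_rel_iff hp, Finset.mem_filter, Finset.mem_univ, true_and,
      Finset.mem_compl, Perm.mem_support, not_not]
    refine ⟨fun h => h _ (Or.inr rfl), ?_⟩
    rintro h y (rfl | rfl)
    · rfl
    · exact h
  rw [h1, Finset.card_compl]
  have := Finset.card_le_univ p.support
  omega

/-- A partition with as many blocks as if all blocks had at most two elements is the cycle
partition of an involution. -/
theorem exists_involution {α : Type*} [Fintype α] [DecidableEq α] {q : Setoid α}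
    (h : 2 * numBlocks q = Fintype.card α + numSingletons q) :
    ∃ p : Perm α, (∀ x, p (p x) = x) ∧ q = cyclePartition p := by
  classical
  let w : α → ℕ := fun y => 1 + if ∀ z, q y z → z = y then 1 else 0
  have hw : ∑ y, w y = Fintype.card α + numSingletons q := by
    simp only [w, Finset.sum_add_distrib, ← Finset.card_filter]
    rw [numSingletons, Nat.card_eq_fintype_card, Fintype.card_subtype]
    simp
  have hblock : ∀ x, 2 ≤ ∑ y with q x y, w y := by
    intro x
    have hx : x ∈ Finset.univ.filter fun y => q x y :=
      Finset.mem_filter.2 ⟨Finset.mem_univ _, q.refl' x⟩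
    by_cases h1 : ∀ z, q x z → z = x
    · refine le_trans ?_ (Finset.single_le_sum (fun _ _ => Nat.zero_le _) hx)
      simp [w, if_pos h1]
    · push Not at h1
      obtain ⟨z, hz, hne⟩ := h1
      have hsub : ({x, z} : Finset α) ⊆ Finset.univ.filter fun y => q x y := by
        intro y hy
        simp only [Finset.mem_insert, Finset.mem_singleton] at hy
        rcases hy with rfl | rfl
        · exact hx
        · exact Finset.mem_filter.2 ⟨Finset.mem_univ _, hz⟩
      refine le_trans ?_ (Finset.sum_le_sum_of_subset hsub)
      rw [Finset.sum_pair hne.symm]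
      simp only [w]
      omega
  have heq := sum_block_eq q w 2 hblock (by omega)
  -- Three points in one block would weigh at least 3, but equality in the count gives every block
  -- weight exactly 2.
  have htwo : ∀ x y z, q x y → q x z → y ≠ x → z ≠ x → y = z := by
    intro x y z hy hz hyx hzx
    by_contra hyz
    have hsub : ({x, y, z} : Finset α) ⊆ Finset.univ.filter fun y => q x y := by
      intro t ht
      simp only [Finset.mem_insert, Finset.mem_singleton] at ht
      refine Finset.mem_filter.2 ⟨Finset.mem_univ _, ?_⟩
      rcases ht with rfl | rfl | rfl
      · exact q.refl' _
      · exact hy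
      · exact hz
    have h1 := Finset.sum_le_sum_of_subset (f := w) hsub
    rw [heq x] at h1
    have h2 : ({x, y, z} : Finset α).card ≤ ∑ t ∈ ({x, y, z} : Finset α), w t := by
      rw [Finset.card_eq_sum_ones]
      exact Finset.sum_le_sum fun t _ => by simp [w]
    rw [Finset.card_eq_three.2 ⟨x, y, z, hyx.symm, hzx.symm, hyz, rfl⟩] at h2
    omega
  have hex : ∀ x, ∃ y, q x y ∧ ∀ z, q x z → z = x ∨ z = y := by
    intro x
    by_cases h1 : ∀ z, q x z → z = x
    · exact ⟨x, q.refl' x, fun z hz => Or.inl (h1 z hz)⟩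
    · push Not at h1
      obtain ⟨y, hy, hne⟩ := h1
      refine ⟨y, hy, fun z hz => ?_⟩
      by_cases hzx : z = x
      · exact Or.inl hzx
      · exact Or.inr (htwo x z y hz hy hzx hne)
  choose f hf1 hf2 using hex
  have hinv : Function.Involutive f := by
    intro x
    rcases hf2 x _ (q.trans' (hf1 x) (hf1 (f x))) with h1 | h1
    · exact h1
    · rcases hf2 (f x) x (q.symm' (hf1 x)) with h2 | h2
      · rw [← h2, ← h2]
      · exact h2.symm
  refine ⟨hinv.toPerm f, hinv, ?_⟩
  ext x y
  rw [cyclePartition_rel_iff (g := hinv.toPerm f) hinv]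
  refine ⟨hf2 x y, ?_⟩
  rintro (rfl | rfl)
  · exact q.refl' _
  · exact hf1 x

/-! ### The genus -/

/-- The partition into the two sides. -/
def sidePartition (n : ℕ) : Setoid (Fin (2 * n)) :=
  Setoid.ker fun x => (⟨x.1 % 2, Nat.mod_lt _ two_pos⟩ : Fin 2)

theorem sidePartition_rel {n : ℕ} {x y : Fin (2 * n)} :
    sidePartition n x y ↔ SameSide x y := by
  change (⟨x.1 % 2, _⟩ : Fin 2) = ⟨y.1 % 2, _⟩ ↔ x.1 % 2 = y.1 % 2
  rw [Fin.ext_iff]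

theorem numBlocks_sidePartition {n : ℕ} (hn : 1 ≤ n) : numBlocks (sidePartition n) = 2 := by
  have hsurj : Function.Surjective
      fun x : Fin (2 * n) => (⟨x.1 % 2, Nat.mod_lt _ two_pos⟩ : Fin 2) := by
    intro y
    have := y.2
    exact ⟨⟨y.1, by omega⟩, Fin.ext (Nat.mod_eq_of_lt y.2)⟩
  rw [numBlocks, sidePartition, Nat.card_congr (Setoid.quotientKerEquivOfSurjective _ hsurj),
    Nat.card_eq_fintype_card, Fintype.card_fin]

theorem gB_top {n : ℕ} (i : Fin n) : gB n (top i) = bot i := by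
  ext; simp only [val_gB, top, bot]; split_ifs <;> omega

theorem gB_bot {n : ℕ} (i : Fin n) : gB n (bot i) = top i := by rw [← gB_top, gB_gB]

theorem eq_top_or_bot {n : ℕ} (x : Fin (2 * n)) : ∃ i, x = top i ∨ x = bot i := by
  have := x.2
  refine ⟨⟨x.1 / 2, by omega⟩, ?_⟩
  simp only [Fin.ext_iff, top, bot]
  omega

theorem cyclePartition_tau (n : ℕ) : cyclePartition (tau n) = sidePartition n := by
  apply le_antisymm
  · refine cyclePartition_le_iff.2 fun x => sidePartition_rel.2 ?_
    simp only [SameSide, tau, Perm.mul_apply, val_gA, val_gB]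
    have := x.2
    split_ifs <;> omega
  · have htop : ∀ (j : ℕ) (hj : j < n),
        cyclePartition (tau n) (top ⟨0, by omega⟩) (top ⟨j, hj⟩) := by
      intro j
      induction j with
      | zero => intro hj; exact Setoid.refl' _ _
      | succ j ih =>
        intro hj
        refine Setoid.trans' _ (ih (by omega)) ?_
        convert cyclePartition_rel_apply (tau n) _ using 1
        ext
        rw [tau, Perm.mul_apply, gB_top]
        simp only [val_gA, bot, top]
        split_ifs <;> first | contradiction | omega
    have hbot : ∀ (j : ℕ) (hj : j < n),
        cyclePartition (tau n) (bot ⟨0, by omega⟩) (bot ⟨j, hj⟩) := by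
      intro j
      induction j with
      | zero => intro hj; exact Setoid.refl' _ _
      | succ j ih =>
        intro hj
        refine Setoid.trans' _ (ih (by omega)) (Setoid.symm' _ ?_)
        convert cyclePartition_rel_apply (tau n) _ using 1
        ext
        rw [tau, Perm.mul_apply, gB_bot]
        simp only [val_gA, bot, top]
        split_ifs <;> first | contradiction | omega
    intro x y hxy
    have hxy := sidePartition_rel.1 hxy
    obtain ⟨i, rfl | rfl⟩ := eq_top_or_bot x <;> obtain ⟨j, rfl | rfl⟩ := eq_top_or_bot y
    · exact Setoid.trans' _ (Setoid.symm' _ (htop i.1 i.2)) (htop j.1 j.2)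
    · simp only [SameSide, top, bot] at hxy; omega
    · simp only [SameSide, top, bot] at hxy; omega
    · exact Setoid.trans' _ (Setoid.symm' _ (hbot i.1 i.2)) (hbot j.1 j.2)

theorem numBlocks_sup_tau_of_sameSide {n : ℕ} (hn : 1 ≤ n) {h : Perm (Fin (2 * n))}
    (hs : ∀ x, SameSide (h x) x) : numBlocks (cyclePartition h ⊔ cyclePartition (tau n)) = 2 := by
  rw [cyclePartition_tau, sup_eq_right.2 (cyclePartition_le_iff.2 fun x =>
    sidePartition_rel.2 (hs x).symm), numBlocks_sidePartition hn]

theorem numBlocks_sup_tau_of_not_sameSide {n : ℕ} {h : Perm (Fin (2 * n))} {x : Fin (2 * n)}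
    (hx : ¬ SameSide (h x) x) :
    numBlocks (cyclePartition h ⊔ cyclePartition (tau n)) = 1 := by
  set S := cyclePartition h ⊔ cyclePartition (tau n) with hS
  have hside : ∀ y z, SameSide y z → S y z := by
    intro y z hyz
    have hle : cyclePartition (tau n) ≤ S := le_sup_right
    rw [cyclePartition_tau] at hle
    exact hle (sidePartition_rel.2 hyz)
  have hall : ∀ y, S x y := by
    intro y
    by_cases hy : SameSide x y
    · exact hside _ _ hy
    · refine S.trans' (sup_rel_left h (tau n) x) (hside _ _ ?_)
      simp only [SameSide] at *
      omega
  rw [numBlocks, Nat.card_eq_one_iff_unique]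
  refine ⟨⟨fun a b => ?_⟩, ⟨⟦x⟧⟩⟩
  induction a using Quotient.inductionOn with
  | h a =>
    induction b using Quotient.inductionOn with
    | h b => exact Quotient.sound (S.trans' (S.symm' (hall a)) (hall b))

/-- For an involution `p`, the genus of `p g_B` is determined by the number of regions. -/
theorem genus_mul_gB_eq_zero_iff {n : ℕ} (hn : 1 ≤ n) {p : Perm (Fin (2 * n))}
    (hp : ∀ x, p (p x) = x) :
    genus (tau n) (p * gB n) = 0 ↔
      4 * n + 2 * numBlocks (cyclePartition (p * gB n) ⊔ cyclePartition (tau n)) =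
        2 * numRegions p + p.support.card + 2 := by
  have hA := four_mul_numBlocks_sup hp (gA_gA (n := n)) gA_ne
  have hB := four_mul_numBlocks_sup hp (gB_gB (n := n)) gB_ne
  have d1 := cayleyDist_add_numBlocks (tau n) (p * gB n)
  have d2 := cayleyDist_add_numBlocks (p * gB n) 1
  have d3 := cayleyDist_add_numBlocks (tau n) 1
  -- Since `tau n = gA n * gB n`, the element `(tau n)⁻¹ * (p * gB n)` is conjugate by `gB n` to the
  -- inverse of `p * gA n`.
  have e1 : numBlocks (cyclePartition ((tau n)⁻¹ * (p * gB n))) =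
      numBlocks (cyclePartition (p * gA n)) := by
    rw [← cyclePartition_inv (p * gA n), ← numBlocks_cyclePartition_conj (gB n)⁻¹ (p * gA n)⁻¹]
    congr 2
    rw [tau, mul_inv_rev, mul_inv_rev, inv_eq_self_of_involutive hp, inv_inv]
    simp only [mul_assoc]
  rw [mul_one, cyclePartition_inv] at d2 d3
  rw [cyclePartition_tau, numBlocks_sidePartition hn] at d3
  rw [e1] at d1
  rw [Fintype.card_fin] at *
  rw [genus, cyclePartition_tau, numBlocks_sidePartition hn, ← cyclePartition_tau, numRegions]
  generalize numBlocks (cyclePartition (p * gB n) ⊔ cyclePartition (tau n)) = J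
  have hq : (cayleyDist (tau n) (p * gB n) : ℚ) + cayleyDist (p * gB n) 1 - cayleyDist (tau n) 1
      - 2 * (((2 : ℕ) : ℚ) - J) = ((cayleyDist (tau n) (p * gB n) + cayleyDist (p * gB n) 1
        + 2 * J : ℕ) : ℚ) - ((cayleyDist (tau n) 1 + 4 : ℕ) : ℚ) := by
    push_cast; ring
  rw [hq, div_eq_zero_iff, or_iff_left two_ne_zero, sub_eq_zero, Nat.cast_inj]
  omega

/-! ### Cutting open along a defect -/

theorem commute_rotation_gB (n : ℕ) : Commute (rotation n) (gB n) := by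
  have h1 : finRotate (2 * n) * gB n = gA n * finRotate (2 * n) := by simp [gA]
  have h2 : finRotate (2 * n) * gA n = gB n * finRotate (2 * n) := by
    rw [← finRotate_conj_gA]; simp
  rw [Commute, SemiconjBy, rotation, pow_two, mul_assoc, h1, ← mul_assoc, h2, mul_assoc]

theorem rotation_pow_eq (n r : ℕ) : rotation n ^ r = finRotate (2 * n) ^ (2 * r) := by
  rw [rotation, pow_mul]

/-- A partial matching with unmatched points leaves some point of the bottom unmatched. -/
theorem exists_fixed_bot {n : ℕ} {p : Perm (Fin (2 * n))} (hp : ∀ x, p (p x) = x)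
    (hpar : ∀ a, p a ≠ a → (p a).1 % 2 ≠ a.1 % 2) {x : Fin (2 * n)} (hx : p x = x) :
    ∃ i : Fin n, p (bot i) = bot i := by
  obtain ⟨i, rfl | rfl⟩ := eq_top_or_bot x
  rotate_left
  · exact ⟨i, hx⟩
  by_contra! hc
  have htop : ∀ j, ∃ l : Fin n, p (bot j) = top l := by
    intro j
    obtain ⟨l, h | h⟩ := eq_top_or_bot (p (bot j))
    · exact ⟨l, h⟩
    · have := hpar _ (hc j)
      rw [h] at this
      simp only [bot] at this
      omega
  choose f hf using htop
  -- If every bottom point were matched, `f` would inject the bottom points into the equally many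
  -- top points and so reach the unmatched `top i`.
  have hinj : Function.Injective f := by
    intro j l hjl
    have h1 : p (bot j) = p (bot l) := by rw [hf, hf, hjl]
    have h2 := congrArg Fin.val (p.injective h1)
    simp only [bot] at h2
    exact Fin.ext (by omega)
  obtain ⟨j, hj⟩ := Finite.surjective_of_injective hinj i
  have h1 : p (top i) = bot j := by rw [← hj, ← hf, hp]
  rw [hx] at h1
  have h2 := congrArg Fin.val h1
  simp only [top, bot] at h2
  omega

/-- The last unmatched point gets the first rainbow position `2 * n`. If it is the last point of the
circle, this is the normalization that `k` sends the last ordinary point to the first defect. An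
arrow of `k` into a defect comes from an unmatched bottom point, an arrow out of one ends at an
unmatched top point; the gluing joins each to its vertical neighbour, as `p * gB n` does. -/
theorem exists_gluing_of_last {n d : ℕ} {p : Perm (Fin (2 * n))} (hp : ∀ x, p (p x) = x)
    (hnc : IsCyclicNC p) (hcard : p.support.card + 2 * d = 2 * n)
    (hlast : d ≠ 0 → ∀ l : Fin (2 * n), l.1 + 1 = 2 * n → p l = l) :
    ∃ k : Perm (Fin (n + d)), IsDefectNC n d k ∧ IsGluing k k⁻¹ (p * gB n) := by
  have hlast' : ∀ w, p w = w → ∀ l : Fin (2 * n), l.1 + 1 = 2 * n → p l = l := by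
    intro w hw
    refine hlast ?_
    rintro rfl
    have h1 : p.support = Finset.univ := by
      rw [← Finset.card_eq_iff_eq_univ, Fintype.card_fin]
      omega
    exact Perm.mem_support.1 (h1 ▸ Finset.mem_univ w) hw
  obtain ⟨s, hs, hsne, hsnc, hsp, hsd⟩ := exists_rainbow hp hnc hlast' hcard
  obtain ⟨k, hk⟩ := exists_perm_top_bot hs (hsnc.parity hs hsne)
  have hk' : ∀ i, s (top (k i)) = bot i := fun i => by rw [← hk, hs]
  have hkinv : ∀ i j, k⁻¹ i = j ↔ k j = i := fun i j => by
    rw [Perm.inv_eq_iff_eq, eq_comm]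
  have hval : ∀ {i j}, k i = j → (s (bot i)).1 = 2 * j.1 := by
    rintro i j rfl; rw [hk]; rfl
  have hval' : ∀ {i j}, k i = j → (s (top j)).1 = 2 * i.1 + 1 := by
    rintro i j rfl; rw [hk']; rfl
  refine ⟨k, ⟨hsnc.isNC hs hk, fun j => ?_, fun j => ?_, fun i j hi hj => ?_⟩, ?_, ?_, ?_, ?_⟩
  · have h1 := hsd (bot (Fin.natAdd n j)) (by simp only [bot, Fin.val_natAdd]; omega)
    rw [hval rfl] at h1
    exact ⟨⟨(k (Fin.natAdd n j)).1, by omega⟩, Fin.ext rfl⟩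
  · have h1 := hsd (top (Fin.natAdd n j)) (by simp only [top, Fin.val_natAdd]; omega)
    rw [hval' (k.apply_symm_apply _)] at h1
    refine ⟨⟨(k.symm (Fin.natAdd n j)).1, by omega⟩, ?_⟩
    exact k.apply_symm_apply (Fin.natAdd n j)
  · have hjd := j.2
    have h1 := (hsp (bot i) (bot (Fin.castAdd d i)) rfl).2.2
      (hlast (by omega) _ (by simp only [bot]; omega)) (by simp only [bot]; omega)
    rw [hval rfl] at h1
    ext
    simp only [Fin.val_natAdd]
    omega
  · intro i i' h
    rw [Perm.mul_apply, gB_top]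
    obtain ⟨h1, h2, -⟩ := hsp (bot i) (bot (Fin.castAdd d i)) rfl
    rw [hval h] at h1 h2
    simp only [Fin.val_castAdd] at h1 h2
    have hi := i'.2
    exact Fin.ext (h1 fun h3 => by have := h2 h3; omega).symm
  · intro i i' h
    rw [hkinv] at h
    rw [Perm.mul_apply, gB_bot]
    obtain ⟨h1, h2, -⟩ := hsp (top i) (top (Fin.castAdd d i)) rfl
    rw [hval' h] at h1 h2
    simp only [Fin.val_castAdd] at h1 h2
    have hi := i'.2
    exact Fin.ext (h1 fun h3 => by have := h2 h3; omega).symm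
  · intro i i' j h h'
    rw [hkinv] at h'
    obtain rfl : i = i' := Fin.castAdd_injective n d (k.injective (h.trans h'.symm))
    rw [Perm.mul_apply, gB_top]
    by_contra hne
    have h1 := (hsp (bot i) (bot (Fin.castAdd d i)) rfl).1 hne
    have h2 := (p (bot i)).2
    rw [hval h, Fin.val_natAdd] at h1
    omega
  · intro i i' j h h'
    rw [hkinv] at h
    obtain rfl : i = i' := Fin.castAdd_injective n d (h.symm.trans h')
    rw [Perm.mul_apply, gB_bot]
    by_contra hne
    have h1 := (hsp (top i) (top (Fin.castAdd d i)) rfl).1 hne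
    have h2 := (p (top i)).2
    rw [hval' h, Fin.val_natAdd] at h1
    omega

theorem exists_gluing {n d : ℕ} {p : Perm (Fin (2 * n))} (hp : ∀ x, p (p x) = x)
    (hnc : IsCyclicNC p) (hcard : p.support.card + 2 * d = 2 * n) :
    ∃ (r : ℕ) (k : Perm (Fin (n + d))) (h₀ : Perm (Fin (2 * n))), IsDefectNC n d k ∧
      IsGluing k k⁻¹ h₀ ∧ p * gB n = rotation n ^ r * h₀ * (rotation n ^ r)⁻¹ := by
  by_cases hd : d = 0
  · obtain ⟨k, h1, h2⟩ := exists_gluing_of_last hp hnc hcard fun h => absurd hd h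
    exact ⟨0, k, _, h1, h2, by simp⟩
  obtain ⟨x, hx⟩ : ∃ x, p x = x := by
    by_contra! hc
    have := support_card_of_ne hc
    rw [Fintype.card_fin] at this
    omega
  obtain ⟨i, hi⟩ := exists_fixed_bot hp hnc.parity hx
  set c := rotation n ^ (i.1 + 1) with hc
  set p₀ := c⁻¹ * p * c with hp₀
  have hpp : p = c * p₀ * c⁻¹ := by rw [hp₀]; group
  have happ : ∀ y, p (c y) = c (p₀ y) := fun y => by
    conv_lhs => rw [hpp]
    rw [conj_apply_apply]
  have hinv : ∀ y, p₀ (p₀ y) = y := fun y => c.injective (by rw [← happ, ← happ, hp])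
  have hnc₀ : IsCyclicNC p₀ := by
    refine isCyclicNC_of_finRotate_pow (2 * (i.1 + 1)) ?_
    rw [← rotation_pow_eq, ← hc, ← hpp]
    exact hnc
  have hcard₀ : p₀.support.card + 2 * d = 2 * n := by
    rw [hpp, Perm.card_support_conj] at hcard
    exact hcard
  obtain ⟨k, h1, h2⟩ := exists_gluing_of_last hinv hnc₀ hcard₀ fun _ l hl => by
    -- The last point has index `2n - 1`; adding `2 (i + 1)` gives `2i + 1` modulo `2n`.
    have hcl : c l = bot i := by
      ext
      rw [hc, rotation_pow_eq, val_finRotate_pow]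
      have h3 : l.1 + 2 * (i.1 + 1) = 2 * i.1 + 1 + 2 * n := by omega
      rw [h3, Nat.add_mod_right, Nat.mod_eq_of_lt (by have := i.2; omega)]
      rfl
    exact c.injective (by rw [← happ, hcl, hi])
  refine ⟨i.1 + 1, k, _, h1, h2, ?_⟩
  have hcomm : Commute c (gB n) := (commute_rotation_gB n).pow_left _
  rw [← hc, mul_assoc c, mul_assoc p₀, ← (hcomm.inv_left).eq, ← mul_assoc, ← mul_assoc, ← hpp]

end AnnularNC

/-! ### The equivalence -/

theorem mainTheorem5 (n nd : ℕ) (hn : 1 ≤ n) (hnd : nd ≤ n) (q : Setoid (Fin (2 * n))) :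
    (AnnularNC.numSingletons q = 2 * nd ∧
      AnnularNC.numBlocks q = n + nd ∧
      AnnularNC.numBlocks (q ⊔ AnnularNC.tA n) + AnnularNC.numBlocks (q ⊔ AnnularNC.tB n)
        = n + nd + (if nd = 0 then 1 else 0)) ↔
    ∃ h : Equiv.Perm (Fin (2 * n)),
      AnnularNC.IsDefectDiagram n nd h ∧
      q = AnnularNC.cyclePartition (h * AnnularNC.gB n) := by
  open AnnularNC Equiv in
  constructor
  · rintro ⟨hq1, hq2, hq3⟩
    obtain ⟨p, hp, rfl⟩ := exists_involution (q := q) (by rw [Fintype.card_fin]; omega)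
    have hs := numSingletons_add_card_support hp
    rw [Fintype.card_fin] at hs
    have hcard : p.support.card + 2 * nd = 2 * n := by omega
    change numRegions p = _ at hq3
    have hext : IsExtremal p := by
      refine ⟨hp, by omega, fun hne => ?_⟩
      have h1 := support_card_of_ne hne
      rw [Fintype.card_fin] at h1
      -- Without unmatched points `nd = 0`, and the additional region in the third condition gives
      -- the stronger bound.
      rw [if_pos (by omega)] at hq3
      omega
    have hnc := hext.isCyclicNC
    have hpg : ∀ x, (p * gB n) (gB n x) = p x := fun x => by rw [Perm.mul_apply, gB_gB]
    have hopp : ∀ x, p x ≠ x → SameSide (p x) (gB n x) := by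
      intro x hx
      have h1 := hnc.parity x hx
      simp only [SameSide, val_gB]
      split_ifs <;> omega
    refine ⟨p * gB n, ⟨fun hd => ?_, fun hd => ?_, ?_, exists_gluing hp hnc hcard⟩, ?_⟩
    · obtain ⟨x, hx⟩ : ∃ x, p x = x := by
        by_contra! hc
        have := support_card_of_ne hc
        rw [Fintype.card_fin] at this
        omega
      have hJ := numBlocks_sup_tau_of_not_sameSide (h := p * gB n) (x := gB n x) (by
        rw [hpg, hx]
        simp only [SameSide, val_gB]
        split_ifs <;> omega)
      refine ⟨(genus_mul_gB_eq_zero_iff hn hp).2 ?_, hJ⟩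
      rw [if_neg hd] at hq3
      omega
    · have hne : ∀ x, p x ≠ x := by
        intro x
        have h1 : p.support = Finset.univ := by
          rw [← Finset.card_eq_iff_eq_univ, Fintype.card_fin]
          omega
        exact Perm.mem_support.1 (h1 ▸ Finset.mem_univ x)
      have hside : ∀ x, SameSide ((p * gB n) x) x := by
        intro x
        have := hopp (gB n x) (hne _)
        rwa [gB_gB] at this
      have hJ := numBlocks_sup_tau_of_sameSide hn hside
      refine ⟨(genus_mul_gB_eq_zero_iff hn hp).2 ?_, hside⟩
      rw [if_pos hd] at hq3
      omega
    · refine ⟨p.supportᶜ, ?_, fun x hx => ?_, fun x hx => ?_⟩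
      · rw [Finset.card_compl, Fintype.card_fin]
        omega
      · rw [hpg]
        simpa using hx
      · rw [hpg, hpg]
        exact ⟨hopp x (by simpa using hx), hp x⟩
    · rw [mul_assoc, mul_self_eq_one_of_involutive gB_gB, mul_one]
  · rintro ⟨h, ⟨hanc, hfac, ⟨D, hD, hD1, hD2⟩, -⟩, rfl⟩
    set p := h * gB n with hpdef
    have hh : h = p * gB n := by
      rw [hpdef, mul_assoc, mul_self_eq_one_of_involutive gB_gB, mul_one]
    change ∀ x ∈ D, p x = x at hD1
    change ∀ x ∉ D, SameSide (p x) (gB n x) ∧ p (p x) = x at hD2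
    have hp : ∀ x, p (p x) = x := by
      intro x
      by_cases hx : x ∈ D
      · rw [hD1 x hx, hD1 x hx]
      · exact (hD2 x hx).2
    -- Outside `D`, `p x` lies on the side of `gB n x`, opposite to `x`; so `D` is exactly the set
    -- of unmatched points.
    have hsupp : p.support = Dᶜ := by
      ext x
      rw [Perm.mem_support, Finset.mem_compl]
      refine ⟨fun h1 h2 => h1 (hD1 x h2), fun h1 h2 => ?_⟩
      have h3 := (hD2 x h1).1
      rw [h2] at h3
      simp only [SameSide, val_gB] at h3
      split_ifs at h3 <;> omega
    have hcard : p.support.card + 2 * nd = 2 * n := by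
      rw [hsupp, Finset.card_compl, Fintype.card_fin]
      omega
    have h1 := numSingletons_add_card_support hp
    have h2 := two_mul_numBlocks_of_involutive hp
    rw [Fintype.card_fin] at h1 h2
    refine ⟨by omega, by omega, ?_⟩
    change numRegions p = _
    rw [hh] at hanc hfac
    split_ifs with hd
    · have h3 := (genus_mul_gB_eq_zero_iff hn hp).1 (hfac hd).1
      rw [numBlocks_sup_tau_of_sameSide hn (hfac hd).2] at h3
      omega
    · have h3 := (genus_mul_gB_eq_zero_iff hn hp).1 (hanc hd).1
      rw [(hanc hd).2] at h3
      omega
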